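/- Let $d\in\{2,3\}$, let $\Omega\subset\mathbb R^d$ be a bounded (nonempty, open) convex polytope, and let $\boldsymbol A\in L^\infty(\Omega;\mathbb R^d)$ with $\operatorname{div}\boldsymbol A=0$ in $\Omega$ and $\boldsymbol A\cdot\mathbf n=0$ on $\partial\Omega$ (both in the weak sense). Spaces of complex-valued functions are regarded as real vector spaces, with $(v,w)_{L^2(S)}:=\operatorname{Re}\int_S v\,w^*\,dx$. For $\kappa>0$ put $\|v\|_{H^1_\kappa}^2:=\|v\|_{L^2(\Omega)}^2+\kappa^{-2}\|\nabla v\|_{L^2(\Omega)}^2$, and for $\beta\ge 0$ and $T\subset\overline\Omega$ put $$a_{\beta,T}(v,w):=\big(\tfrac{\mathrm i}{\kappa}\nabla v+\boldsymbol A v,\tfrac{\mathrm i}{\kappa}\nabla w+\boldsymbol A w\big)_{L^2(T)}+\beta\,(v,w)_{L^2(T)},\qquad a_\beta:=a_{\beta,\Omega}.$$ Let $\mathcal T_h$ be a conforming partition of $\Omega$ into triangles ($d=2$) or tetrahedra ($d=3$) of mesh size $h:=\max_{T\in\mathcal T_h}\operatorname{diam}T$, which is shape-regular with constant $\sigma$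 (every $T$ contains a ball of radius $r>0$ with $\operatorname{diam}T\le\sigma r$) and quasi-uniform with constant $q$ ($h\le q\operatorname{diam}T$ for all $T$). Let $V_h\subset H^1(\Omega)$ be the space of $H^1$-functions that are affine on every $T\in\mathcal T_h$, let $\pi_h$ be the $L^2$-projection onto $V_h$, and let $W:=\{w\in H^1(\Omega):\pi_hw=0\}$. For $v_h\in V_h$ and $T\in\mathcal T_h$ the element corrector $\mathcal C_Tv_h\in W$ is given by $a_\beta(\mathcal C_Tv_h,w)=a_{\beta,T}(v_h,w)$ for all $w\in W$, and the LOD space is $$V_h^{\rm LOD}:=\Big\{v_h-\sum_{T\in\mathcal T_h}\mathcal C_Tv_h : v_h\in V_h\Big\}.$$ With $\tilde\beta:=\tfrac12+\|\boldsymbol A\|_{L^\infty(\Omega)}^2$, the Ritz projection $R_h^{\rm LOD}:H^1(\Omega)\to V_h^{\rm LOD}$ is given by $a_{\tilde\beta}(R_h^{\rm LOD}v,w)=a_{\tilde\beta}(v,w)$ for all $w\in V_h^{\rm LOD}$. Call $C_{\rm res}>0$ a resolution constant (for $\Omega,\boldsymbol A,\sigma,q$) if for all $\kappa>0$, all such meshes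 with $h\le C_{\rm res}\kappa^{-1}$ and all $\beta\ge0$ one has $a_\beta(w,w)\ge\tfrac14\|w\|_{H^1_\kappa}^2+\beta\|w\|_{L^2(\Omega)}^2$ for all $w\in W$. Then, for given $\Omega,\boldsymbol A,\sigma,q$, a resolution constant exists, and there is a constant $C>0$ depending only on $\Omega,\boldsymbol A,\sigma,q$ (in particular not on $h,\kappa,\beta$) such that the following holds for every resolution constant $C_{\rm res}$, every $\kappa>0$, every such mesh with $h\le C_{\rm res}\kappa^{-1}$ and every $\beta\ge 0$. The projection $\pi_h:L^2(\Omega)\to V_h$, the element correctors $\mathcal C_T$ and the Ritz projection $R_h^{\rm LOD}$ are well defined; and if $z\in H^1(\Omega)$ and $f\in L^2(\Omega)$ satisfy $a_\beta(z,w)=(f,w)_{L^2(\Omega)}$ for all $w\in H^1(\Omega)$, then $$\|z-R_h^{\rm LOD}z\|_{H^1_\kappa}\le C\,h\kappa\,\|f-\pi_hf\|_{L^2(\Omega)}$$ and $$\|z-R_h^{\rm LOD}z\|_{L^2(\Omega)}\le C\,h\kappa\,\sqrt{1+\beta}\;\|z-R_h^{\rm LOD}z\|_{H^1_\kappa}.$$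 -/

import Mathlib

open MeasureTheory Set
open scoped ContDiff ENNReal

noncomputable section

namespace LOD

/-- Euclidean space `ℝ^d`. -/
abbrev E (d : ℕ) : Type := EuclideanSpace ℝ (Fin d)

/-- `L²(Ω; ℂ)`, with Lebesgue measure on `Ω`. -/
abbrev L2 {d : ℕ} (Ω : Set (E d)) : Type := Lp ℂ 2 ((volume : Measure (E d)).restrict Ω)

/-- The real inner product `(v, w)_{L²(S)} = Re ∫_S v w^*`. -/
def l2Inner {d : ℕ} (S : Set (E d)) (v w : E d → ℂ) : ℝ :=
  (∫ x in S, v x * (starRingEnd ℂ) (w x)).re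

/-- The partial derivative `∂_i φ`. -/
def partialDeriv {d : ℕ} (φ : E d → ℝ) (i : Fin d) (x : E d) : ℝ :=
  fderiv ℝ φ x (EuclideanSpace.single i 1)

/-- Smooth test functions with compact support contained in `Ω`. -/
structure IsTestFunction {d : ℕ} (Ω : Set (E d)) (φ : E d → ℝ) : Prop where
  smooth : ContDiff ℝ ∞ φ
  compact : HasCompactSupport φ
  support : tsupport φ ⊆ Ω

/-- `g` is the weak gradient of `u` on `Ω`. (Real test functions suffice: the identity is complex
linear in the test function.) -/
def IsWeakGrad {d : ℕ} (Ω : Set (E d)) (u : E d → ℂ) (g : Fin d → E d → ℂ) : Prop :=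
  ∀ φ : E d → ℝ, IsTestFunction Ω φ → ∀ i : Fin d,
    ∫ x in Ω, u x * (partialDeriv φ i x : ℂ) = - ∫ x in Ω, g i x * (φ x : ℂ)

theorem IsTestFunction.memLp {d : ℕ} {Ω : Set (E d)} {φ : E d → ℝ} (h : IsTestFunction Ω φ) :
    MemLp (fun x => (φ x : ℂ)) 2 ((volume : Measure (E d)).restrict Ω) := by
  have h1 : MemLp φ 2 ((volume : Measure (E d)).restrict Ω) :=
    h.smooth.continuous.memLp_of_hasCompactSupport h.compact
  exact h1.ofReal

theorem IsTestFunction.memLp_partialDeriv {d : ℕ} {Ω : Set (E d)} {φ : E d → ℝ}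
    (h : IsTestFunction Ω φ) (i : Fin d) :
    MemLp (fun x => (partialDeriv φ i x : ℂ)) 2 ((volume : Measure (E d)).restrict Ω) := by
  have hc : Continuous (partialDeriv φ i) :=
    (h.smooth.continuous_fderiv (by simp)).clm_apply continuous_const
  have hs : HasCompactSupport (partialDeriv φ i) := h.compact.fderiv_apply ℝ _
  have h1 : MemLp (partialDeriv φ i) 2 ((volume : Measure (E d)).restrict Ω) :=
    hc.memLp_of_hasCompactSupport hs
  exact h1.ofReal

theorem integral_add_mul {d : ℕ} {Ω : Set (E d)} (u v : L2 Ω) {ψ : E d → ℂ}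
    (hψ : MemLp ψ 2 ((volume : Measure (E d)).restrict Ω)) :
    ∫ x in Ω, (u + v : L2 Ω) x * ψ x = (∫ x in Ω, u x * ψ x) + ∫ x in Ω, v x * ψ x := by
  have h := integral_add ((Lp.memLp u).integrable_mul hψ) ((Lp.memLp v).integrable_mul hψ)
  simp only [Pi.mul_apply] at h
  rw [← h]
  refine integral_congr_ae ?_
  filter_upwards [Lp.coeFn_add u v] with x hx
  rw [hx]
  simp [add_mul]

theorem integral_smul_mul {d : ℕ} {Ω : Set (E d)} (c : ℝ) (u : L2 Ω) (ψ : E d → ℂ) :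
    ∫ x in Ω, (c • u : L2 Ω) x * ψ x = c • ∫ x in Ω, u x * ψ x := by
  rw [← integral_smul]
  refine integral_congr_ae ?_
  filter_upwards [Lp.coeFn_smul c u] with x hx
  rw [hx]
  simp [mul_assoc]

theorem integral_zero_mul {d : ℕ} {Ω : Set (E d)} (ψ : E d → ℂ) :
    ∫ x in Ω, (0 : L2 Ω) x * ψ x = 0 := by
  have h := integral_smul_mul (0 : ℝ) (0 : L2 Ω) ψ
  simpa using h

/-- The Sobolev space `H¹(Ω; ℂ)` as a real vector space; an element is a pair consisting of an
`L²` function and its (unique) weak gradient, whose components are in `L²`. -/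
def H1 {d : ℕ} (Ω : Set (E d)) : Submodule ℝ (L2 Ω × (Fin d → L2 Ω)) where
  carrier := {p | IsWeakGrad Ω p.1 (fun i => p.2 i)}
  add_mem' := by
    intro p q hp hq φ hφ i
    have e1 := integral_add_mul p.1 q.1 (hφ.memLp_partialDeriv i)
    have e2 := integral_add_mul (p.2 i) (q.2 i) hφ.memLp
    have e3 := hp φ hφ i
    have e4 := hq φ hφ i
    simp only [Prod.fst_add, Prod.snd_add, Pi.add_apply] at *
    rw [e1, e2, e3, e4, neg_add]
  zero_mem' := by
    intro φ hφ i
    have e1 := integral_zero_mul (Ω := Ω) (fun x => (partialDeriv φ i x : ℂ))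
    have e2 := integral_zero_mul (Ω := Ω) (fun x => (φ x : ℂ))
    simp only [Prod.fst_zero, Prod.snd_zero, Pi.zero_apply]
    rw [e1, e2, neg_zero]
  smul_mem' := by
    intro c p hp φ hφ i
    have e1 := integral_smul_mul c p.1 (fun x => (partialDeriv φ i x : ℂ))
    have e2 := integral_smul_mul c (p.2 i) (fun x => (φ x : ℂ))
    have e3 := hp φ hφ i
    simp only [Prod.smul_fst, Prod.smul_snd, Pi.smul_apply] at *
    rw [e1, e2, e3, smul_neg]

/-- The underlying `L²` function of an element of `H¹(Ω)`. -/
def toL2 {d : ℕ} {Ω : Set (E d)} (v : H1 Ω) : L2 Ω := v.1.1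

/-- The weak partial derivative `∂_i v` of an element of `H¹(Ω)`. -/
def grad {d : ℕ} {Ω : Set (E d)} (v : H1 Ω) (i : Fin d) : L2 Ω := v.1.2 i

/-- `‖v‖_{H¹_κ(Ω)} = (‖v‖² + κ⁻² ‖∇v‖²)^{1/2}`, with `L²(Ω)` norms on the right. -/
def normκ {d : ℕ} {Ω : Set (E d)} (κ : ℝ) (v : H1 Ω) : ℝ :=
  Real.sqrt (‖toL2 v‖ ^ 2 + 1 / κ ^ 2 * ∑ i, ‖grad v i‖ ^ 2)

/-- A bounded convex polytope, as a nonempty open set: the interior of the convex hull of finitely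
many points. -/
def IsConvexPolytope {d : ℕ} (Ω : Set (E d)) : Prop :=
  Ω.Nonempty ∧ ∃ s : Finset (E d), Ω = interior (convexHull ℝ (s : Set (E d)))

/-- `∫_Ω A · ∇φ`. -/
def gradPairing {d : ℕ} (Ω : Set (E d)) (A : E d → E d) (φ : E d → ℝ) : ℝ :=
  ∫ x in Ω, ∑ i, A x i * partialDeriv φ i x

/-- A magnetic potential: `A ∈ L^∞(Ω; ℝ^d)` with `div A = 0` in `Ω` (in the sense of distributions)
and `A · n = 0` on `∂Ω`. The normal trace of a divergence free field is the functional
`φ ↦ ∫_Ω A · ∇φ` on (the traces of) functions which are smooth up to the boundary. -/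
structure IsMagneticPotential {d : ℕ} (Ω : Set (E d)) (A : E d → E d) : Prop where
  memLp : MemLp A ∞ ((volume : Measure (E d)).restrict Ω)
  div_free : ∀ φ : E d → ℝ, IsTestFunction Ω φ → gradPairing Ω A φ = 0
  normal_trace : ∀ φ : E d → ℝ, ContDiff ℝ ∞ φ → HasCompactSupport φ → gradPairing Ω A φ = 0

/-- `‖A‖_{L^∞(Ω)}`. -/
def supNorm {d : ℕ} (Ω : Set (E d)) (A : E d → E d) : ℝ :=
  (eLpNorm A ∞ ((volume : Measure (E d)).restrict Ω)).toReal

/-- The `i`-th component of `(i/κ) ∇v + A v`. -/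
def magGrad {d : ℕ} {Ω : Set (E d)} (A : E d → E d) (κ : ℝ) (v : H1 Ω) (i : Fin d) (x : E d) : ℂ :=
  Complex.I / (κ : ℂ) * grad v i x + (A x i : ℂ) * (toL2 v) x

/-- The bilinear form `((i/κ) ∇v + A v, (i/κ) ∇w + A w)_{L²(S)} + β (v, w)_{L²(S)}` on a subset
`S` of `Ω`. -/
def aFormOn {d : ℕ} {Ω : Set (E d)} (A : E d → E d) (κ β : ℝ) (S : Set (E d)) (v w : H1 Ω) : ℝ :=
  (∑ i, l2Inner S (magGrad A κ v i) (magGrad A κ w i)) + β * l2Inner S (toL2 v) (toL2 w)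

/-- The bilinear form `a_β` on `H¹(Ω)`. -/
def aForm {d : ℕ} {Ω : Set (E d)} (A : E d → E d) (κ β : ℝ) (v w : H1 Ω) : ℝ :=
  aFormOn A κ β Ω v w

/-- A conforming partition of (the closure of) `Ω` into finitely many nondegenerate simplices, each
given by its set of `d + 1` vertices. -/
structure Mesh {d : ℕ} (Ω : Set (E d)) where
  elems : Finset (Finset (E d))
  card_eq : ∀ K ∈ elems, K.card = d + 1
  indep : ∀ K ∈ elems, AffineIndependent ℝ ((↑) : K → E d)
  conforming : ∀ K ∈ elems, ∀ L ∈ elems,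
    convexHull ℝ (K : Set (E d)) ∩ convexHull ℝ (L : Set (E d)) ⊆
      convexHull ℝ ((K : Set (E d)) ∩ (L : Set (E d)))
  covers : ⋃ K ∈ elems, convexHull ℝ (K : Set (E d)) = closure Ω

/-- The diameter of the simplex with vertex set `K`. -/
def simplexDiam {d : ℕ} (K : Finset (E d)) : ℝ := Metric.diam (convexHull ℝ (K : Set (E d)))

/-- The mesh size `h = max_K diam K`. -/
def Mesh.size {d : ℕ} {Ω : Set (E d)} (T : Mesh Ω) : ℝ := ⨆ K : T.elems, simplexDiam K.1

/-- Shape regularity with constant `σ`: each element `K` contains a ball of radius `r` with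
`diam K ≤ σ r`. -/
def Mesh.ShapeRegular {d : ℕ} {Ω : Set (E d)} (T : Mesh Ω) (σ : ℝ) : Prop :=
  ∀ K ∈ T.elems, ∃ (x : E d) (r : ℝ), 0 < r ∧
    Metric.closedBall x r ⊆ convexHull ℝ (K : Set (E d)) ∧ simplexDiam K ≤ σ * r

/-- Quasi-uniformity with constant `q`: `h ≤ q diam K` for each element `K`. -/
def Mesh.QuasiUniform {d : ℕ} {Ω : Set (E d)} (T : Mesh Ω) (q : ℝ) : Prop :=
  ∀ K ∈ T.elems, T.size ≤ q * simplexDiam K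

/-- The conforming `P¹` Lagrange space `V_h`: functions in `H¹(Ω)` which are affine on every
element. -/
def Mesh.Vh {d : ℕ} {Ω : Set (E d)} (T : Mesh Ω) : Set (H1 Ω) :=
  {v | ∀ K ∈ T.elems, ∃ (a : ℂ) (b : Fin d → ℂ),
    ∀ᵐ x ∂((volume : Measure (E d)).restrict Ω), x ∈ convexHull ℝ (K : Set (E d)) →
      toL2 v x = a + ∑ i, b i * (x i : ℂ)}

/-- `p = π_h f`, the `L²` projection of `f` onto `V_h`. -/
def Mesh.IsL2Proj {d : ℕ} {Ω : Set (E d)} (T : Mesh Ω) (f : L2 Ω) (p : H1 Ω) : Prop :=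
  p ∈ T.Vh ∧ ∀ v ∈ T.Vh, l2Inner Ω (toL2 p) (toL2 v) = l2Inner Ω f (toL2 v)

/-- The detail space `W = {w ∈ H¹(Ω) | π_h w = 0}`. -/
def Mesh.W {d : ℕ} {Ω : Set (E d)} (T : Mesh Ω) : Set (H1 Ω) :=
  {w | T.IsL2Proj (toL2 w) 0}

/-- `c = C_K v`, the element corrector of `v` for the element `K`: `c ∈ W` and
`a_β(c, w) = a_{β,K}(v, w)` for all `w ∈ W`. -/
def Mesh.IsElementCorrector {d : ℕ} {Ω : Set (E d)} (T : Mesh Ω) (A : E d → E d) (κ β : ℝ)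
    (K : Finset (E d)) (v c : H1 Ω) : Prop :=
  c ∈ T.W ∧ ∀ w ∈ T.W,
    aForm A κ β c w = aFormOn A κ β (Ω ∩ convexHull ℝ (K : Set (E d))) v w

/-- The LOD space `{v - ∑_K C_K v | v ∈ V_h}` built from `a_β`. -/
def Mesh.Vlod {d : ℕ} {Ω : Set (E d)} (T : Mesh Ω) (A : E d → E d) (κ β : ℝ) : Set (H1 Ω) :=
  {u | ∃ v ∈ T.Vh, ∃ c : Finset (E d) → H1 Ω,
    (∀ K ∈ T.elems, T.IsElementCorrector A κ β K v (c K)) ∧ u = v - ∑ K ∈ T.elems, c K}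

/-- The fixed stabilization `1/2 + ‖A‖²_{L^∞(Ω)}` used for the Ritz projection. -/
def betaTilde {d : ℕ} (Ω : Set (E d)) (A : E d → E d) : ℝ := 1 / 2 + supNorm Ω A ^ 2

/-- `r` is the Ritz projection of `v` onto the LOD space built from `a_β`; the projection is with
respect to the form with parameter `betaTilde`. -/
def Mesh.IsRitzProj {d : ℕ} {Ω : Set (E d)} (T : Mesh Ω) (A : E d → E d) (κ β : ℝ)
    (v r : H1 Ω) : Prop :=
  r ∈ T.Vlod A κ β ∧ ∀ w ∈ T.Vlod A κ β,
    aForm A κ (betaTilde Ω A) r w = aForm A κ (betaTilde Ω A) v w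

/-- `Cres` is a resolution constant for `A`, `Ω` and the mesh regularity constants `σ`, `q`: if
`h ≤ Cres κ⁻¹`, then `a_β(w,w) ≥ ‖w‖²_{H¹_κ} / 4 + β ‖w‖²_{L²}` on `W`, for every `β ≥ 0`. -/
def IsResolutionConstant {d : ℕ} (Ω : Set (E d)) (A : E d → E d) (σ q Cres : ℝ) : Prop :=
  0 < Cres ∧ ∀ κ : ℝ, 0 < κ → ∀ T : Mesh Ω, T.ShapeRegular σ → T.QuasiUniform q →
    T.size ≤ Cres * κ⁻¹ → ∀ β : ℝ, 0 ≤ β → ∀ w ∈ T.W,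
      1 / 4 * normκ κ w ^ 2 + β * ‖toL2 w‖ ^ 2 ≤ aForm A κ β w w

end LOD

end

/-!
The argument is a Céa estimate followed by an Aubin–Nitsche duality argument; the one analytic
input is the approximation property `‖u - π_h u‖ ≤ C h ‖∇u‖` for `u ∈ H¹(Ω)`.

*Approximation.* Put a fixed ball `B(x₀, ρ)` into `Ω` and let `D` be the diameter of `Ω`. To a vertex
`p` assign the average of `u` over the image of this ball under the homothety with centre `p` and
ratio `h / D`. By convexity this image lies in `Ω`, and it is within distance `h` of `p`. The nodal
interpolant `v` of these averages is affine on each simplex, so at a point `x` of a simplex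
`|u(x) - v(x)|` is at most `|u(x) - avg_p|` for some vertex `p` of it. By Jensen's inequality,
`‖u - v‖²` is controlled by the integral of `|u(x) - u(y)|²` over the pairs at distance at most `2h`.
The translation estimate `∫ |u(x + z) - u(x)|² ≤ |z|² ‖∇u‖²` on the convex set `Ω` bounds this
(`exists_quasiInterpolant`). The powers of `h` match, as the volumes compared are those of two balls
with radii proportional to `h`.

*Resolution.* For `w ∈ W` the approximation property reads `‖w‖ ≤ C h ‖∇w‖`, so that for small `hκ`
the term `‖A w‖²` is absorbed and `a_β` is coercive on `W`.

*The LOD space.* Summing the corrector equations over the elements shows that `V_h^LOD` is the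
`a_β`-orthogonal complement of `W` in `H¹(Ω)` (`Mesh.Vlod_eq_orthW`). In particular it is closed, so
that the correctors and the Ritz projection exist by Lax–Milgram on closed subspaces, and every `z`
splits as `z = (z - w₀) + w₀` with `z - w₀` in the LOD space and `w₀ ∈ W`.

*Estimates.* If `z` solves the problem with right-hand side `f`, then
`a_β(w₀, w₀) = (f - π_h f, w₀)`, and `‖w₀‖ ≤ C hκ ‖w₀‖_{H¹_κ}` gives the energy estimate with Céa's
lemma. For the `L²` estimate one solves `a_β̃(φ, ·) = (e, ·)` with `e = z - R z`. The component of
`φ` in `W` satisfies an equation with the additional term `(β - β̃)(φ - π_h φ, w₀)`. As `a_β`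
controls `β ‖w₀‖²`, Young's inequality turns the factor `β` into `√β`.
-/

noncomputable section

namespace LOD

/-! ### Translation estimates for Sobolev functions on convex sets -/

/-- Jensen's inequality for the square of the norm. -/
theorem enorm_integral_sq_le_lintegral {α : Type*} [MeasurableSpace α] {ν : Measure α}
    [IsProbabilityMeasure ν] {f : α → ℂ} (hf : AEStronglyMeasurable f ν) :
    ‖∫ x, f x ∂ν‖ₑ ^ 2 ≤ ∫⁻ x, ‖f x‖ₑ ^ 2 ∂ν := by
  have h1 : ‖∫ x, f x ∂ν‖ₑ ≤ eLpNorm f 2 ν :=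
    calc ‖∫ x, f x ∂ν‖ₑ ≤ ∫⁻ x, ‖f x‖ₑ ∂ν := enorm_integral_le_lintegral_enorm f
      _ = eLpNorm f 1 ν := eLpNorm_one_eq_lintegral_enorm.symm
      _ ≤ eLpNorm f 2 ν := eLpNorm_le_eLpNorm_of_exponent_le (by norm_num) hf
  calc ‖∫ x, f x ∂ν‖ₑ ^ 2 ≤ eLpNorm f 2 ν ^ 2 := by gcongr
    _ = ∫⁻ x, ‖f x‖ₑ ^ 2 ∂ν := by
      have := eLpNorm_nnreal_pow_eq_lintegral (p := 2) (f := f) (μ := ν) (by norm_num)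
      simpa using! this

theorem L2.enorm_sq_eq_lintegral {d : ℕ} {Ω : Set (E d)} (u : L2 Ω) :
    ‖u‖ₑ ^ 2 = ∫⁻ x in Ω, ‖u x‖ₑ ^ 2 := by
  have := eLpNorm_nnreal_pow_eq_lintegral (p := 2) (f := u)
    (μ := (volume : Measure (E d)).restrict Ω) (by norm_num)
  rw [Lp.enorm_def]
  simpa using! this

theorem fderiv_apply_eq_sum {d : ℕ} (φ : E d → ℝ) (x z : E d) :
    fderiv ℝ φ x z = ∑ i, z i * partialDeriv φ i x := by
  conv_lhs => rw [← (EuclideanSpace.basisFun (Fin d) ℝ).sum_repr z]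
  simp [partialDeriv, map_sum]

theorem IsTestFunction.translate {d : ℕ} {Ω Ω' : Set (E d)} {φ : E d → ℝ}
    (h : IsTestFunction Ω φ) (z : E d) (hz : ∀ x ∈ Ω, x + z ∈ Ω') :
    IsTestFunction Ω' (fun x => φ (x - z)) := by
  have hs : tsupport (fun x => φ (x - z)) = (fun x => x - z) ⁻¹' tsupport φ := by
    exact tsupport_comp_eq_preimage φ (Homeomorph.subRight z)
  refine ⟨h.smooth.comp (contDiff_id.sub contDiff_const), ?_, ?_⟩
  · exact h.compact.comp_homeomorph (Homeomorph.subRight z)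
  · rw [hs]
    intro x hx
    simpa using hz _ (h.support hx)

/-- The directional derivative `∇w · z` of an element of `H¹(Ω)`, as a function. -/
def dirGrad {d : ℕ} {Ω : Set (E d)} (w : H1 Ω) (z : E d) (x : E d) : ℂ :=
  ∑ i, (z i : ℂ) * grad w i x

theorem stronglyMeasurable_dirGrad {d : ℕ} {Ω : Set (E d)} (w : H1 Ω) (z : E d) :
    StronglyMeasurable (dirGrad w z) := by
  unfold dirGrad
  refine Finset.stronglyMeasurable_fun_sum _ fun i _ => ?_
  exact stronglyMeasurable_const.mul (Lp.stronglyMeasurable _)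

theorem memLp_dirGrad {d : ℕ} {Ω : Set (E d)} (w : H1 Ω) (z : E d) :
    MemLp (dirGrad w z) 2 ((volume : Measure (E d)).restrict Ω) := by
  unfold dirGrad
  exact memLp_finsetSum _ fun i _ => (Lp.memLp (grad w i)).const_mul _

theorem isWeakGrad {d : ℕ} {Ω : Set (E d)} (w : H1 Ω) : IsWeakGrad Ω (toL2 w) (fun i => grad w i) :=
  w.2

theorem integral_mul_fderiv {d : ℕ} {Ω : Set (E d)} (w : H1 Ω) {φ : E d → ℝ}
    (hφ : IsTestFunction Ω φ) (z : E d) :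
    ∫ x in Ω, toL2 w x * (fderiv ℝ φ x z : ℂ) = - ∫ x in Ω, dirGrad w z x * (φ x : ℂ) := by
  have h1 : ∀ i, Integrable (fun x => (z i : ℂ) * (toL2 w x * (partialDeriv φ i x : ℂ)))
      ((volume : Measure (E d)).restrict Ω) := fun i =>
    ((Lp.memLp (toL2 w)).integrable_mul (hφ.memLp_partialDeriv i)).const_mul _
  have h2 : ∀ i, Integrable (fun x => (z i : ℂ) * (grad w i x * (φ x : ℂ)))
      ((volume : Measure (E d)).restrict Ω) := fun i =>
    ((Lp.memLp (grad w i)).integrable_mul hφ.memLp).const_mul _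
  calc ∫ x in Ω, toL2 w x * (fderiv ℝ φ x z : ℂ)
      = ∫ x in Ω, ∑ i, (z i : ℂ) * (toL2 w x * (partialDeriv φ i x : ℂ)) := by
        congr 1; ext x
        rw [fderiv_apply_eq_sum]; push_cast
        rw [Finset.mul_sum]; exact Finset.sum_congr rfl fun i _ => by ring
    _ = ∑ i, (z i : ℂ) * ∫ x in Ω, toL2 w x * (partialDeriv φ i x : ℂ) := by
        rw [integral_finsetSum _ fun i _ => h1 i]
        exact Finset.sum_congr rfl fun i _ => integral_const_mul _ _
    _ = ∑ i, (z i : ℂ) * -∫ x in Ω, grad w i x * (φ x : ℂ) :=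
        Finset.sum_congr rfl fun i _ => by rw [isWeakGrad w φ hφ i]
    _ = - ∑ i, ∫ x in Ω, (z i : ℂ) * (grad w i x * (φ x : ℂ)) := by
        rw [← Finset.sum_neg_distrib]
        exact Finset.sum_congr rfl fun i _ => by rw [integral_const_mul]; ring
    _ = - ∫ x in Ω, dirGrad w z x * (φ x : ℂ) := by
        rw [← integral_finsetSum _ fun i _ => h2 i]
        congr 2; ext x
        rw [dirGrad, Finset.sum_mul]; exact Finset.sum_congr rfl fun i _ => by ring

theorem lintegral_dirGrad_le {d : ℕ} {Ω : Set (E d)} (w : H1 Ω) (z : E d) :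
    ∫⁻ x in Ω, ‖dirGrad w z x‖ₑ ^ 2 ≤ ‖z‖ₑ ^ 2 * ∑ i, ‖grad w i‖ₑ ^ 2 := by
  have hp : ∀ x, ‖dirGrad w z x‖ₑ ^ 2 ≤ ‖z‖ₑ ^ 2 * ∑ i, ‖grad w i x‖ₑ ^ 2 := by
    intro x
    have h1 : ‖dirGrad w z x‖ ^ 2 ≤ ‖z‖ ^ 2 * ∑ i, ‖grad w i x‖ ^ 2 := by
      calc ‖dirGrad w z x‖ ^ 2 ≤ (∑ i, ‖z i‖ * ‖grad w i x‖) ^ 2 := by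
            gcongr
            refine (norm_sum_le _ _).trans (le_of_eq ?_)
            exact Finset.sum_congr rfl fun i _ => by rw [norm_mul]; simp
        _ ≤ (∑ i, ‖z i‖ ^ 2) * ∑ i, ‖grad w i x‖ ^ 2 := Finset.sum_mul_sq_le_sq_mul_sq _ _ _
        _ = _ := by rw [EuclideanSpace.norm_sq_eq]
    have h2 := ENNReal.ofReal_le_ofReal h1
    rw [ENNReal.ofReal_mul (by positivity), ENNReal.ofReal_sum_of_nonneg (fun i _ => by positivity),
      ENNReal.ofReal_pow (norm_nonneg _), ENNReal.ofReal_pow (norm_nonneg _)] at h2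
    simpa only [ofReal_norm, ENNReal.ofReal_pow (norm_nonneg _)] using h2
  refine (lintegral_mono hp).trans (le_of_eq ?_)
  rw [lintegral_const_mul' _ _ (by simp), lintegral_finsetSum']
  · simp_rw [L2.enorm_sq_eq_lintegral]
  · intro i _
    exact (Lp.aestronglyMeasurable (grad w i)).enorm.pow_const 2


theorem integrable_indicator_of_memLp {d : ℕ} {Ω : Set (E d)} (hb : Bornology.IsBounded Ω)
    (hm : MeasurableSet Ω) {f : E d → ℂ}
    (hf : MemLp f 2 ((volume : Measure (E d)).restrict Ω)) : Integrable (Ω.indicator f) := by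
  rw [integrable_indicator_iff hm]
  have : IsFiniteMeasure ((volume : Measure (E d)).restrict Ω) :=
    ⟨by simpa using hb.measure_lt_top⟩
  exact hf.integrable (by norm_num)

theorem integrable_prod_translate {d : ℕ} {g : E d → ℂ} (hg : Integrable g)
    (hgm : StronglyMeasurable g) (z : E d) :
    Integrable (fun p : ℝ × E d => g (p.2 + p.1 • z))
      ((volume.restrict (Ioc (0 : ℝ) 1)).prod volume) := by
  have hm : StronglyMeasurable (fun p : ℝ × E d => g (p.2 + p.1 • z)) :=
    hgm.comp_measurable (by fun_prop)
  rw [integrable_prod_iff hm.aestronglyMeasurable]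
  refine ⟨.of_forall fun t => hg.comp_add_right (t • z), ?_⟩
  have : (fun t : ℝ => ∫ x : E d, ‖g (x + t • z)‖) = fun _ => ∫ x, ‖g x‖ := by
    ext t
    exact integral_add_right_eq_self (fun x => ‖g x‖) (t • z)
  simp only [this]
  exact integrable_const _

/-- The fundamental theorem of calculus along the segments from `x` to `x + z`, for functions in `H¹`
of a convex set. It follows by testing with `φ` and moving the translations onto `φ`: convexity makes
every intermediate translate of `φ` a test function on `Ω`. -/
theorem translate_sub_ae_eq {d : ℕ} {Ω : Set (E d)} (ho : IsOpen Ω) (hc : Convex ℝ Ω)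
    (hb : Bornology.IsBounded Ω) (w : H1 Ω) (z : E d) :
    ∀ᵐ x, x ∈ Ω ∩ (fun x => x + z) ⁻¹' Ω →
      Ω.indicator (toL2 w) (x + z) - Ω.indicator (toL2 w) x
        = ∫ t in Ioc (0 : ℝ) 1, Ω.indicator (dirGrad w z) (x + t • z) := by
  set W := Ω.indicator (toL2 w) with hW
  set G := Ω.indicator (dirGrad w z) with hG
  have hWi : Integrable W := integrable_indicator_of_memLp hb ho.measurableSet (Lp.memLp _)
  have hGi : Integrable G := integrable_indicator_of_memLp hb ho.measurableSet (memLp_dirGrad w z)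
  have hGm : StronglyMeasurable G := (stronglyMeasurable_dirGrad w z).indicator ho.measurableSet
  have hGp := integrable_prod_translate hGi hGm z
  have hWz : Integrable (fun x => W (x + z)) := hWi.comp_add_right z
  have hI : Integrable (fun x => ∫ t in Ioc (0 : ℝ) 1, G (x + t • z)) := hGp.integral_prod_right
  have hU : IsOpen (Ω ∩ (fun x => x + z) ⁻¹' Ω) :=
    ho.inter (ho.preimage (by fun_prop))
  have key := hU.ae_eq_zero_of_integral_contDiff_smul_eq_zero
    (f := fun x => W (x + z) - W x - ∫ t in Ioc (0 : ℝ) 1, G (x + t • z)) (μ := volume)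
    (LocallyIntegrable.locallyIntegrableOn (Integrable.locallyIntegrable
      (by exact (hWz.sub hWi).sub hI)) _) ?_
  · filter_upwards [key] with x hx hxU
    exact sub_eq_zero.1 (hx hxU)
  intro φ hφs hφc hφU
  have hφ : IsTestFunction (Ω ∩ (fun x => x + z) ⁻¹' Ω) φ := ⟨hφs, hφc, hφU⟩
  obtain ⟨B, hB⟩ := hφc.exists_bound_of_continuous hφs.continuous
  have hbd : ∀ {f : E d → ℂ}, Integrable f → Integrable (fun x => φ x • f x) := fun hf =>
    hf.bdd_smul B hφs.continuous.aestronglyMeasurable (.of_forall hB)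
  have hφ't : Continuous (fun x => fderiv ℝ φ x z) :=
    (hφs.continuous_fderiv (by simp)).clm_apply continuous_const
  obtain ⟨B', hB'⟩ := (hφc.fderiv_apply ℝ z).exists_bound_of_continuous hφ't
  -- The term with the weak gradient, with all derivatives moved to the test function.
  have h3 : ∫ x, φ x • ∫ t in Ioc (0 : ℝ) 1, G (x + t • z)
      = ∫ x, W x * ((φ (x - z) : ℂ) - φ x) := by
    calc ∫ x, φ x • ∫ t in Ioc (0 : ℝ) 1, G (x + t • z)
        = ∫ x, ∫ t in Ioc (0 : ℝ) 1, φ x • G (x + t • z) := by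
          congr 1; ext x; exact (integral_smul _ _).symm
      _ = ∫ t in Ioc (0 : ℝ) 1, ∫ x, φ x • G (x + t • z) := by
          refine (integral_integral_swap ?_).symm
          exact hGp.bdd_smul B (φ := fun p : ℝ × E d => φ p.2)
            (hφs.continuous.comp continuous_snd).aestronglyMeasurable (.of_forall fun p => hB p.2)
      _ = ∫ t in Ioc (0 : ℝ) 1, ∫ x, W x * (-fderiv ℝ φ (x - t • z) z : ℂ) := by
          refine setIntegral_congr_fun measurableSet_Ioc fun t ht => ?_
          have ht' : ∀ x ∈ Ω ∩ (fun x => x + z) ⁻¹' Ω, x + t • z ∈ Ω := fun x hx => by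
            have := hc hx.1 hx.2 (a := 1 - t) (b := t) (by linarith [ht.2]) ht.1.le (by ring)
            convert this using 1
            module
          have hφt := hφ.translate (t • z) ht'
          have e1 : ∫ x, φ x • G (x + t • z) = ∫ x in Ω, dirGrad w z x * (φ (x - t • z) : ℂ) := by
            rw [← integral_sub_right_eq_self (fun x => φ x • G (x + t • z)) (t • z),
              ← integral_indicator ho.measurableSet]
            congr 1; ext x
            by_cases hx : x ∈ Ω <;> simp [hG, hx, mul_comm]
          have e2 : ∫ x, W x * (-fderiv ℝ φ (x - t • z) z : ℂ)
              = ∫ x in Ω, toL2 w x * (-fderiv ℝ (fun y => φ (y - t • z)) x z : ℂ) := by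
            rw [← integral_indicator ho.measurableSet]
            congr 1; ext x
            have hf : fderiv ℝ (fun y => φ (y - t • z)) x = fderiv ℝ φ (x - t • z) :=
              fderiv_comp_sub (t • z)
            by_cases hx : x ∈ Ω <;> simp [hW, hx, hf]
          rw [e1, e2, ← neg_eq_iff_eq_neg.2 (integral_mul_fderiv w hφt z), ← integral_neg]
          simp
      _ = ∫ x, ∫ t in Ioc (0 : ℝ) 1, W x * (-fderiv ℝ φ (x - t • z) z : ℂ) := by
          refine integral_integral_swap ?_
          refine Integrable.mul_bdd (c := B') (hWi.comp_snd _) ?_ ?_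
          · refine Continuous.aestronglyMeasurable ?_
            have : Continuous fun p : ℝ × E d => fderiv ℝ φ (p.2 - p.1 • z) z :=
              hφ't.comp (by fun_prop)
            fun_prop
          · refine .of_forall fun p => ?_
            simpa using hB' (p.2 - p.1 • z)
      _ = _ := by
          congr 1; ext x
          rw [integral_const_mul]
          congr 1
          have hd : ∀ t : ℝ, HasDerivAt (fun t : ℝ => (φ (x - t • z) : ℂ))
              (-fderiv ℝ φ (x - t • z) z : ℂ) t := fun t => by
            have h1 : HasDerivAt (fun t : ℝ => x - t • z) (-z) t := by
              simpa using ((hasDerivAt_id t).smul_const z).const_sub x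
            have h2 := ((hφs.differentiable (by simp) (x - t • z)).hasFDerivAt).comp_hasDerivAt t h1
            simpa using h2.ofReal_comp
          rw [← intervalIntegral.integral_of_le zero_le_one,
            intervalIntegral.integral_eq_sub_of_hasDerivAt (fun t _ => hd t)]
          · simp
          · refine Continuous.intervalIntegrable ?_ _ _
            have : Continuous fun t : ℝ => fderiv ℝ φ (x - t • z) z := hφ't.comp (by fun_prop)
            fun_prop
  have h1 : ∫ x, φ x • W (x + z) = ∫ x, W x * (φ (x - z) : ℂ) := by
    rw [← integral_sub_right_eq_self (fun x => φ x • W (x + z)) z]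
    congr 1; ext x; simp [mul_comm]
  have h2 : ∫ x, φ x • W x = ∫ x, W x * (φ x : ℂ) := by
    congr 1; ext x; simp [mul_comm]
  simp only [smul_sub]
  rw [integral_sub (by exact (hbd hWz).sub (hbd hWi)) (hbd hI), integral_sub (hbd hWz) (hbd hWi), h3, h1, h2]
  simp only [mul_sub]
  rw [integral_sub, sub_self]
  · refine hWi.mul_bdd (c := B) ?_ (.of_forall fun x => by simpa using hB (x - z))
    exact (Complex.continuous_ofReal.comp
      (hφs.continuous.comp (continuous_id.sub continuous_const))).aestronglyMeasurable
  · refine hWi.mul_bdd (c := B) ?_ (.of_forall fun x => by simpa using hB x)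
    exact (Complex.continuous_ofReal.comp hφs.continuous).aestronglyMeasurable

/-- The translation estimate `∫ |w(x + z) - w(x)|² ≤ |z|² ‖∇w‖²`, over those `x ∈ Ω` for which
`x + z ∈ Ω`. -/
theorem lintegral_translate_sub_le {d : ℕ} {Ω : Set (E d)} (ho : IsOpen Ω) (hc : Convex ℝ Ω)
    (hb : Bornology.IsBounded Ω) (w : H1 Ω) (z : E d) :
    ∫⁻ x in Ω ∩ (fun x => x + z) ⁻¹' Ω, ‖toL2 w (x + z) - toL2 w x‖ₑ ^ 2
      ≤ ‖z‖ₑ ^ 2 * ∑ i, ‖grad w i‖ₑ ^ 2 := by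
  set G := Ω.indicator (dirGrad w z) with hG
  have hGm : StronglyMeasurable G := (stronglyMeasurable_dirGrad w z).indicator ho.measurableSet
  have hUm : MeasurableSet (Ω ∩ (fun x => x + z) ⁻¹' Ω) :=
    (ho.inter (ho.preimage (by fun_prop))).measurableSet
  have : IsProbabilityMeasure ((volume : Measure ℝ).restrict (Ioc (0 : ℝ) 1)) := ⟨by simp⟩
  calc ∫⁻ x in Ω ∩ (fun x => x + z) ⁻¹' Ω, ‖toL2 w (x + z) - toL2 w x‖ₑ ^ 2
      ≤ ∫⁻ x in Ω ∩ (fun x => x + z) ⁻¹' Ω, ∫⁻ t in Ioc (0 : ℝ) 1, ‖G (x + t • z)‖ₑ ^ 2 := by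
        refine lintegral_mono_ae ?_
        rw [ae_restrict_iff' hUm]
        filter_upwards [translate_sub_ae_eq ho hc hb w z] with x hx hxU
        have h := hx hxU
        rw [indicator_of_mem hxU.1, indicator_of_mem (show x + z ∈ Ω from hxU.2)] at h
        rw [h]
        refine enorm_integral_sq_le_lintegral (StronglyMeasurable.aestronglyMeasurable ?_)
        exact hGm.comp_measurable (by fun_prop)
    _ ≤ ∫⁻ x, ∫⁻ t in Ioc (0 : ℝ) 1, ‖G (x + t • z)‖ₑ ^ 2 := setLIntegral_le_lintegral _ _
    _ = ∫⁻ t in Ioc (0 : ℝ) 1, ∫⁻ x, ‖G (x + t • z)‖ₑ ^ 2 := by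
        refine lintegral_lintegral_swap (Measurable.aemeasurable ?_)
        exact ((hGm.measurable.comp (f := fun p : E d × ℝ => p.1 + p.2 • z)
          (by fun_prop)).enorm).pow_const 2
    _ = ∫⁻ t in Ioc (0 : ℝ) 1, ∫⁻ x, ‖G x‖ₑ ^ 2 := by
        congr 1; ext t
        exact lintegral_add_right_eq_self (fun x => ‖G x‖ₑ ^ 2) (t • z)
    _ = ∫⁻ x in Ω, ‖dirGrad w z x‖ₑ ^ 2 := by
        rw [lintegral_const, ← lintegral_indicator ho.measurableSet]
        simp only [measure_univ, mul_one]
        congr 1; ext x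
        by_cases hx : x ∈ Ω <;> simp [hG, hx]
    _ ≤ _ := lintegral_dirGrad_le w z

/-- The translation estimate, integrated over all translations of length at most `R`. -/
theorem lintegral_lintegral_sub_le {d : ℕ} {Ω : Set (E d)} (ho : IsOpen Ω) (hc : Convex ℝ Ω)
    (hb : Bornology.IsBounded Ω) (w : H1 Ω) {R : ℝ} (hR : 0 ≤ R) :
    ∫⁻ x in Ω, ∫⁻ y in Ω ∩ Metric.closedBall x R, ‖toL2 w x - toL2 w y‖ₑ ^ 2
      ≤ ENNReal.ofReal (R ^ 2) * volume (Metric.closedBall (0 : E d) R)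
        * ∑ i, ‖grad w i‖ₑ ^ 2 := by
  have hwm : StronglyMeasurable (toL2 w) := Lp.stronglyMeasurable _
  set F : E d → E d → ℝ≥0∞ := fun z x =>
    (Ω ∩ (fun x => x + z) ⁻¹' Ω).indicator (fun x => ‖toL2 w (x + z) - toL2 w x‖ₑ ^ 2) x with hF
  have hUm : ∀ z : E d, MeasurableSet (Ω ∩ (fun x => x + z) ⁻¹' Ω) := fun z =>
    (ho.inter (ho.preimage (by fun_prop))).measurableSet
  have hFm : Measurable (Function.uncurry F) := by
    have hS : MeasurableSet {p : E d × E d | p.2 ∈ Ω ∧ p.2 + p.1 ∈ Ω} :=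
      (ho.measurableSet.preimage measurable_snd).inter
        (ho.measurableSet.preimage (measurable_snd.add measurable_fst))
    have h0 : Measurable fun p : E d × E d => ‖toL2 w (p.2 + p.1) - toL2 w p.2‖ₑ ^ 2 :=
      ((hwm.measurable.comp (measurable_snd.add measurable_fst)).sub
        (hwm.measurable.comp measurable_snd)).enorm.pow_const 2
    exact h0.indicator hS
  calc ∫⁻ x in Ω, ∫⁻ y in Ω ∩ Metric.closedBall x R, ‖toL2 w x - toL2 w y‖ₑ ^ 2
      = ∫⁻ x, ∫⁻ z in Metric.closedBall 0 R, F z x := by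
        rw [← lintegral_indicator ho.measurableSet]
        congr 1; ext x
        by_cases hx : x ∈ Ω
        · rw [indicator_of_mem hx,
            ← lintegral_indicator (ho.measurableSet.inter Metric.isClosed_closedBall.measurableSet),
            ← lintegral_indicator Metric.isClosed_closedBall.measurableSet,
            ← lintegral_add_left_eq_self _ x]
          congr 1; ext z
          by_cases h1 : x + z ∈ Ω <;> by_cases h2 : ‖z‖ ≤ R <;>
            simp [indicator, hF, hx, h1, h2, enorm_sub_rev]
        · rw [indicator_of_notMem hx]
          simp [hF, hx]
    _ = ∫⁻ z in Metric.closedBall 0 R, ∫⁻ x, F z x :=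
        lintegral_lintegral_swap (hFm.comp measurable_swap).aemeasurable
    _ ≤ ∫⁻ z in Metric.closedBall (0 : E d) R,
          ENNReal.ofReal (R ^ 2) * ∑ i, ‖grad w i‖ₑ ^ 2 := by
        refine setLIntegral_mono measurable_const fun z hz => ?_
        simp only [hF]
        rw [lintegral_indicator (hUm z)]
        refine (lintegral_translate_sub_le ho hc hb w z).trans ?_
        gcongr
        rw [ENNReal.ofReal_pow hR, ← ofReal_norm]
        gcongr
        simpa using hz
    _ = _ := by rw [setLIntegral_const]; ring

/-! ### Lipschitz functions belong to `H¹` -/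

/-- A function which is Lipschitz on each of finitely many closed sets covering a convex set is
Lipschitz on the convex set, with the same constant. -/
theorem lipschitzOnWith_of_closed_cover {V F ι : Type*} [NormedAddCommGroup V] [NormedSpace ℝ V]
    [PseudoMetricSpace F] {s : Set V} (hs : Convex ℝ s) (I : Finset ι) (t : ι → Set V)
    (ht : ∀ i ∈ I, IsClosed (t i)) (hst : s ⊆ ⋃ i ∈ I, t i) {f : V → F} {L : NNReal}
    (hf : ∀ i ∈ I, LipschitzOnWith L f (t i)) : LipschitzOnWith L f s := by
  refine LipschitzOnWith.of_dist_le_mul fun x hx y hy => ?_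
  set γ : ℝ → V := fun a => AffineMap.lineMap (k := ℝ) x y a with hγ
  have hγc : Continuous γ := AffineMap.lineMap_continuous
  have hγd : ∀ a b : ℝ, dist (γ a) (γ b) = dist a b * dist x y := dist_lineMap_lineMap x y
  have hγs : ∀ a ∈ Icc (0 : ℝ) 1, γ a ∈ s := fun a ha => hs.lineMap_mem hx hy ha
  set S : Set ℝ := {a | dist (f x) (f (γ a)) ≤ L * dist x y * a} with hS
  have hclosed : IsClosed (S ∩ Icc 0 1) := by
    have : S ∩ Icc 0 1 = ⋃ i ∈ I, ((Icc 0 1 ∩ γ ⁻¹' t i) ∩ S) := by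
      ext a
      simp only [mem_inter_iff, mem_iUnion, mem_preimage, exists_prop]
      constructor
      · rintro ⟨h1, h2⟩
        obtain ⟨i, hi, hai⟩ := mem_iUnion₂.1 (hst (hγs a h2))
        exact ⟨i, hi, ⟨h2, hai⟩, h1⟩
      · rintro ⟨i, hi, ⟨h2, _⟩, h1⟩
        exact ⟨h1, h2⟩
    rw [this]
    refine I.finite_toSet.isClosed_biUnion fun i hi => ?_
    have hc : ContinuousOn (fun a => f (γ a)) (Icc 0 1 ∩ γ ⁻¹' t i) :=
      (hf i hi).continuousOn.comp hγc.continuousOn fun a ha => ha.2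
    exact (isClosed_Icc.inter ((ht i hi).preimage hγc)).isClosed_le
      (f := fun a => dist (f x) (f (γ a))) (g := fun a => L * dist x y * a)
      (continuous_dist.comp_continuousOn (continuousOn_const.prodMk hc)) (by fun_prop)
  have hsub : Icc (0 : ℝ) 1 ⊆ S := by
    refine hclosed.Icc_subset_of_forall_exists_gt (by simp [hS, hγ]) ?_
    rintro a ⟨haS, ha⟩ b hb
    -- One of the finitely many sets contains `γ c` for `c` arbitrarily close to `a` from the right.
    have hev : ∀ᶠ c in nhdsWithin a (Ioi a), c ∈ Ioc a b ∧ c ∈ Icc (0 : ℝ) 1 := by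
      filter_upwards [Ioc_mem_nhdsGT (lt_min hb ha.2)] with c hc
      exact ⟨⟨hc.1, hc.2.trans (min_le_left _ _)⟩, ha.1.trans hc.1.le, hc.2.trans (min_le_right _ _)⟩
    have hex : ∃ i ∈ I, ∃ᶠ c in nhdsWithin a (Ioi a), γ c ∈ t i := by
      by_contra! hcon
      have h1 : ∀ᶠ c in nhdsWithin a (Ioi a), ∀ i ∈ I, γ c ∉ t i :=
        (Filter.eventually_all_finset I).2 hcon
      obtain ⟨c, hc1, hc2⟩ := (h1.and hev).exists
      obtain ⟨i, hi, hci⟩ := mem_iUnion₂.1 (hst (hγs c hc2.2))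
      exact hc1 i hi hci
    obtain ⟨i, hi, hfr⟩ := hex
    have hai : γ a ∈ t i := by
      refine (ht i hi).mem_of_frequently_of_tendsto hfr ?_
      exact (hγc.tendsto a).mono_left nhdsWithin_le_nhds
    obtain ⟨c, hci, hc⟩ := (hfr.and_eventually hev).exists
    refine ⟨c, ?_, hc.1⟩
    have h2 := (hf i hi).dist_le_mul _ hai _ hci
    rw [hγd, Real.dist_eq, abs_sub_comm, abs_of_pos (sub_pos.2 hc.1.1)] at h2
    have h3 := dist_triangle (f x) (f (γ a)) (f (γ c))
    have h4 : dist (f x) (f (γ a)) ≤ L * dist x y * a := haS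
    show dist (f x) (f (γ c)) ≤ L * dist x y * c
    linarith
  have := hsub (right_mem_Icc.2 zero_le_one)
  simpa [hS, hγ] using this

theorem IsWeakGrad.congr {d : ℕ} {Ω : Set (E d)} {u u' : E d → ℂ} {g g' : Fin d → E d → ℂ}
    (h : IsWeakGrad Ω u g) (hu : u' =ᵐ[(volume : Measure (E d)).restrict Ω] u)
    (hg : ∀ i, g' i =ᵐ[(volume : Measure (E d)).restrict Ω] g i) : IsWeakGrad Ω u' g' := by
  intro φ hφ i
  have e1 : ∫ x in Ω, u' x * (partialDeriv φ i x : ℂ) = ∫ x in Ω, u x * (partialDeriv φ i x : ℂ) :=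
    integral_congr_ae (by filter_upwards [hu] with x hx; rw [hx])
  have e2 : ∫ x in Ω, g' i x * (φ x : ℂ) = ∫ x in Ω, g i x * (φ x : ℂ) :=
    integral_congr_ae (by filter_upwards [hg i] with x hx; rw [hx])
  rw [e1, e2, h φ hφ i]

theorem IsWeakGrad.exists_H1 {d : ℕ} {Ω : Set (E d)} {u : E d → ℂ} {g : Fin d → E d → ℂ}
    (h : IsWeakGrad Ω u g) (hu : MemLp u 2 ((volume : Measure (E d)).restrict Ω))
    (hg : ∀ i, MemLp (g i) 2 ((volume : Measure (E d)).restrict Ω)) :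
    ∃ v : H1 Ω, toL2 v =ᵐ[(volume : Measure (E d)).restrict Ω] u :=
  ⟨⟨(hu.toLp, fun i => (hg i).toLp), h.congr hu.coeFn_toLp fun i => (hg i).coeFn_toLp⟩,
    hu.coeFn_toLp⟩

/-- Integration by parts for Lipschitz functions, a consequence of Rademacher's theorem. -/
theorem integral_mul_partialDeriv_of_lipschitz {d : ℕ} {Ω : Set (E d)} {f : E d → ℝ} {L : NNReal}
    (hf : LipschitzWith L f) {φ : E d → ℝ} (hφ : IsTestFunction Ω φ) (i : Fin d) :
    ∫ x in Ω, f x * partialDeriv φ i x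
      = -∫ x in Ω, lineDeriv ℝ f x (EuclideanSpace.single i 1) * φ x := by
  obtain ⟨D, hD⟩ : ∃ D, LipschitzWith D φ :=
    hφ.smooth.lipschitzWith_of_hasCompactSupport hφ.compact (by simp)
  have h0 : ∀ x ∉ Ω, φ x = 0 := fun x hx =>
    image_eq_zero_of_notMem_tsupport fun h => hx (hφ.support h)
  have h0' : ∀ x ∉ Ω, fderiv ℝ φ x = 0 := fun x hx =>
    fderiv_of_notMem_tsupport ℝ fun h => hx (hφ.support h)
  rw [setIntegral_eq_integral_of_forall_compl_eq_zero fun x hx => by simp [partialDeriv, h0' x hx],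
    setIntegral_eq_integral_of_forall_compl_eq_zero fun x hx => by simp [h0 x hx],
    hf.integral_lineDeriv_mul_eq hD hφ.compact, ← integral_neg]
  congr 1; ext x
  rw [(hφ.smooth.differentiable (by simp) x).lineDeriv_eq_fderiv, partialDeriv]
  simp [mul_comm]

theorem integral_ofReal_add_I_mul {d : ℕ} {Ω : Set (E d)} {a b ψ : E d → ℝ}
    (ha : MemLp a 2 ((volume : Measure (E d)).restrict Ω))
    (hb : MemLp b 2 ((volume : Measure (E d)).restrict Ω))
    (hψ : MemLp (fun x => (ψ x : ℂ)) 2 ((volume : Measure (E d)).restrict Ω)) :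
    ∫ x in Ω, ((a x : ℂ) + Complex.I * (b x : ℂ)) * (ψ x : ℂ)
      = ((∫ x in Ω, a x * ψ x : ℝ) : ℂ) + Complex.I * ((∫ x in Ω, b x * ψ x : ℝ) : ℂ) := by
  have hψ' : MemLp ψ 2 ((volume : Measure (E d)).restrict Ω) := by
    simpa using hψ.re
  have h1 : Integrable (fun x => ((a x * ψ x : ℝ) : ℂ)) ((volume : Measure (E d)).restrict Ω) :=
    (ha.integrable_mul hψ').ofReal
  have h2 : Integrable (fun x => ((b x * ψ x : ℝ) : ℂ)) ((volume : Measure (E d)).restrict Ω) :=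
    (hb.integrable_mul hψ').ofReal
  rw [← integral_complex_ofReal, ← integral_complex_ofReal, ← integral_const_mul,
    ← integral_add h1 (h2.const_mul _)]
  congr 1; ext x; push_cast; ring

theorem memLp_ofReal_add_I_mul {α : Type*} [MeasurableSpace α] {ν : Measure α} {a b : α → ℝ}
    (ha : MemLp a 2 ν) (hb : MemLp b 2 ν) :
    MemLp (fun x => (a x : ℂ) + Complex.I * (b x : ℂ)) 2 ν := by
  have h1 : MemLp (fun x => (a x : ℂ)) 2 ν := ha.ofReal
  have h2 : MemLp (fun x => (b x : ℂ)) 2 ν := hb.ofReal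
  exact h1.add (h2.const_mul Complex.I)

/-- Lipschitz functions on a bounded open set are in `H¹`: the real and imaginary parts extend to
Lipschitz functions on the whole space, whose line derivatives are bounded. -/
theorem exists_H1_of_lipschitzOnWith {d : ℕ} {Ω : Set (E d)} (ho : IsOpen Ω)
    (hb : Bornology.IsBounded Ω) {g : E d → ℂ} {L : NNReal} (hg : LipschitzOnWith L g Ω) :
    ∃ v : H1 Ω, ∀ᵐ x ∂(volume : Measure (E d)).restrict Ω, toL2 v x = g x := by
  have hre : LipschitzOnWith L (fun x => (g x).re) Ω := by
    refine LipschitzOnWith.of_dist_le_mul fun x hx y hy => le_trans ?_ (hg.dist_le_mul x hx y hy)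
    rw [Real.dist_eq, dist_eq_norm, ← Complex.sub_re]
    exact Complex.abs_re_le_norm _
  have him : LipschitzOnWith L (fun x => (g x).im) Ω := by
    refine LipschitzOnWith.of_dist_le_mul fun x hx y hy => le_trans ?_ (hg.dist_le_mul x hx y hy)
    rw [Real.dist_eq, dist_eq_norm, ← Complex.sub_im]
    exact Complex.abs_im_le_norm _
  obtain ⟨f₁, hf₁, he₁⟩ := hre.extend_real
  obtain ⟨f₂, hf₂, he₂⟩ := him.extend_real
  have hfin : IsFiniteMeasure ((volume : Measure (E d)).restrict Ω) :=
    ⟨by simpa using hb.measure_lt_top⟩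
  have hm : ∀ {f : E d → ℝ}, LipschitzWith L f →
      MemLp f 2 ((volume : Measure (E d)).restrict Ω) := by
    intro f hf
    obtain ⟨B, hB⟩ := hb.isCompact_closure.exists_bound_of_continuousOn hf.continuous.continuousOn
    refine MemLp.of_bound hf.continuous.aestronglyMeasurable B ?_
    rw [ae_restrict_iff' ho.measurableSet]
    exact .of_forall fun x hx => hB x (subset_closure hx)
  have hm' : ∀ {f : E d → ℝ}, LipschitzWith L f → ∀ v : E d,
      MemLp (fun x => lineDeriv ℝ f x v) 2 ((volume : Measure (E d)).restrict Ω) := fun hf v =>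
    ((hf.memLp_lineDeriv v).restrict Ω).mono_exponent (by simp)
  have hw : IsWeakGrad Ω (fun x => (f₁ x : ℂ) + Complex.I * (f₂ x : ℂ))
      (fun i x => ((lineDeriv ℝ f₁ x (EuclideanSpace.single i 1) : ℝ) : ℂ)
        + Complex.I * ((lineDeriv ℝ f₂ x (EuclideanSpace.single i 1) : ℝ) : ℂ)) := by
    intro φ hφ i
    have hP := hφ.memLp_partialDeriv i
    have hQ := hφ.memLp
    rw [integral_ofReal_add_I_mul (hm hf₁) (hm hf₂) hP,
      integral_ofReal_add_I_mul (hm' hf₁ _) (hm' hf₂ _) hQ,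
      integral_mul_partialDeriv_of_lipschitz hf₁ hφ, integral_mul_partialDeriv_of_lipschitz hf₂ hφ]
    push_cast
    ring
  obtain ⟨v, hv⟩ := hw.exists_H1
    (memLp_ofReal_add_I_mul (hm hf₁) (hm hf₂))
    (fun i => memLp_ofReal_add_I_mul (hm' hf₁ _) (hm' hf₂ _))
  refine ⟨v, ?_⟩
  filter_upwards [hv, ae_restrict_mem ho.measurableSet] with x hx hxΩ
  rw [hx, ← he₁ hxΩ, ← he₂ hxΩ]
  apply Complex.ext <;> simp

/-! ### Nodal interpolation and quasi-interpolation on a mesh -/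

theorem exists_affineMap_eq_on_vertices {d : ℕ} {K : Finset (E d)} (hcard : K.card = d + 1)
    (hK : AffineIndependent ℝ ((↑) : K → E d)) (c : E d → ℂ) :
    ∃ ℓ : E d →ᵃ[ℝ] ℂ, ∀ p ∈ K, ℓ p = c p := by
  have htop : affineSpan ℝ (range ((↑) : K → E d)) = ⊤ := by
    rw [hK.affineSpan_eq_top_iff_card_eq_finrank_add_one]
    simp [hcard]
  let b : AffineBasis K ℝ (E d) := ⟨_, hK, htop⟩
  refine ⟨(Fintype.linearCombination ℝ (fun p : K => c p)).toAffineMap.comp b.coords, ?_⟩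
  intro q hq
  have hbq : b ⟨q, hq⟩ = q := rfl
  rw [← hbq]
  simp [Fintype.linearCombination_apply, b.coord_apply]
  rw [hbq]

variable {d : ℕ} {Ω : Set (E d)}

theorem Mesh.subset_closure (T : Mesh Ω) {K : Finset (E d)} (hK : K ∈ T.elems) :
    convexHull ℝ (K : Set (E d)) ⊆ closure Ω := by
  rw [← T.covers]
  exact subset_biUnion_of_mem (u := fun K : Finset (E d) => convexHull ℝ (K : Set (E d))) hK

theorem Mesh.exists_mem (T : Mesh Ω) {x : E d} (hx : x ∈ Ω) :
    ∃ K ∈ T.elems, x ∈ convexHull ℝ (K : Set (E d)) := by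
  have := _root_.subset_closure hx
  rw [← T.covers] at this
  simpa using this

theorem isCompact_convexHull_finset (K : Finset (E d)) :
    IsCompact (convexHull ℝ (K : Set (E d))) := K.finite_toSet.isCompact_convexHull ℝ

/-- Every assignment `c` of nodal values extends to a function of `V_h`. The interpolant takes values
in the convex hulls of the nodal values of single simplices; this is recorded in the form needed
later, as a bound for its distance from any number `a`. -/
theorem Mesh.exists_nodal_interpolant (T : Mesh Ω) (ho : IsOpen Ω) (hc : Convex ℝ Ω)
    (hb : Bornology.IsBounded Ω) (c : E d → ℂ) :
    ∃ v ∈ T.Vh, ∀ᵐ x ∂(volume : Measure (E d)).restrict Ω, ∃ K ∈ T.elems,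
      x ∈ convexHull ℝ (K : Set (E d)) ∧ ∀ a : ℂ, ∃ p ∈ K, ‖a - toL2 v x‖ ≤ ‖a - c p‖ := by
  have hex : ∀ K : T.elems, ∃ ℓ : E d →ᵃ[ℝ] ℂ, ∀ p ∈ K.1, ℓ p = c p := fun K =>
    exists_affineMap_eq_on_vertices (T.card_eq K.1 K.2) (T.indep K.1 K.2) c
  choose ℓ hℓ using hex
  have hagree : ∀ K L : T.elems, ∀ x ∈ convexHull ℝ (K.1 : Set (E d)),
      x ∈ convexHull ℝ (L.1 : Set (E d)) → ℓ K x = ℓ L x := by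
    intro K L x hxK hxL
    have hx := T.conforming K.1 K.2 L.1 L.2 ⟨hxK, hxL⟩
    have hconv : Convex ℝ ((ℓ K - ℓ L) ⁻¹' {0}) := (convex_singleton 0).affine_preimage _
    have hsub : ((K.1 : Set (E d)) ∩ (L.1 : Set (E d))) ⊆ (ℓ K - ℓ L) ⁻¹' {0} := fun p hp => by
      have h1 := hℓ K p hp.1
      have h2 := hℓ L p hp.2
      simp [h1, h2]
    have := convexHull_min hsub hconv hx
    simpa [sub_eq_zero] using this
  classical
  set g : E d → ℂ := fun x =>
    if h : ∃ K : T.elems, x ∈ convexHull ℝ (K.1 : Set (E d)) then ℓ h.choose x else 0 with hg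
  have hgK : ∀ K : T.elems, ∀ x ∈ convexHull ℝ (K.1 : Set (E d)), g x = ℓ K x := by
    intro K x hx
    have h : ∃ K : T.elems, x ∈ convexHull ℝ (K.1 : Set (E d)) := ⟨K, hx⟩
    simp only [hg, dif_pos h]
    exact hagree _ _ _ h.choose_spec hx
  set Lc : T.elems → NNReal := fun K => ‖(ℓ K).linear.toContinuousLinearMap‖₊ with hLc
  have hlipK : ∀ K : T.elems, LipschitzWith (Lc K) (ℓ K) := fun K => by
    refine LipschitzWith.of_dist_le_mul fun x y => ?_
    rw [dist_eq_norm, dist_eq_norm, ← vsub_eq_sub, ← AffineMap.linearMap_vsub]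
    exact (ℓ K).linear.toContinuousLinearMap.le_opNorm (x - y)
  have hlip : LipschitzOnWith (Finset.univ.sup Lc) g Ω := by
    refine (lipschitzOnWith_of_closed_cover hc (I := Finset.univ)
      (t := fun K : T.elems => convexHull ℝ (K.1 : Set (E d)))
      (fun K _ => (isCompact_convexHull_finset K.1).isClosed) ?_ ?_)
    · intro x hx
      obtain ⟨K, hK, hxK⟩ := T.exists_mem hx
      simp only [Finset.mem_univ, iUnion_true, mem_iUnion]
      exact ⟨⟨K, hK⟩, hxK⟩
    · intro K _ x hx y hy
      rw [hgK K x hx, hgK K y hy]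
      exact ((hlipK K).weaken (Finset.le_sup (Finset.mem_univ K))) x y
  obtain ⟨v, hv⟩ := exists_H1_of_lipschitzOnWith ho hb hlip
  refine ⟨v, ?_, ?_⟩
  · intro K hK
    refine ⟨ℓ ⟨K, hK⟩ 0, fun i => (ℓ ⟨K, hK⟩).linear (EuclideanSpace.single i 1), ?_⟩
    filter_upwards [hv] with x hx hxK
    have hlin : (ℓ ⟨K, hK⟩).linear x
        = ∑ i, x i • (ℓ ⟨K, hK⟩).linear (EuclideanSpace.single i 1) := by
      conv_lhs => rw [← (EuclideanSpace.basisFun (Fin d) ℝ).sum_repr x]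
      simp [map_sum]
    have hdec := congrFun (AffineMap.decomp (ℓ ⟨K, hK⟩)) x
    rw [hx, hgK ⟨K, hK⟩ x hxK, hdec, Pi.add_apply, hlin, add_comm]
    simp [mul_comm]
  · filter_upwards [hv, ae_restrict_mem ho.measurableSet] with x hx hxΩ
    obtain ⟨K, hK, hxK⟩ := T.exists_mem hxΩ
    refine ⟨K, hK, hxK, fun a => ?_⟩
    have hcv : ConvexOn ℝ univ fun y => ‖a - ℓ ⟨K, hK⟩ y‖ := by
      have h1 : ConvexOn ℝ univ fun b : ℂ => dist b a := convexOn_dist a convex_univ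
      have := h1.comp_affineMap (ℓ ⟨K, hK⟩)
      simpa [Function.comp_def, dist_eq_norm, norm_sub_rev] using this
    obtain ⟨p, hp, hle⟩ := hcv.exists_ge_of_mem_convexHull (subset_univ _) hxK
    refine ⟨p, hp, ?_⟩
    rw [hx, hgK ⟨K, hK⟩ x hxK, ← hℓ ⟨K, hK⟩ p hp]
    exact hle

theorem Mesh.dist_le_size (T : Mesh Ω) {K : Finset (E d)} (hK : K ∈ T.elems) {x y : E d}
    (hx : x ∈ convexHull ℝ (K : Set (E d))) (hy : y ∈ convexHull ℝ (K : Set (E d))) :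
    dist x y ≤ T.size :=
  (Metric.dist_le_diam_of_mem (isCompact_convexHull_finset K).isBounded hx hy).trans
    (le_ciSup (f := fun K : T.elems => simplexDiam K.1) (finite_range _).bddAbove ⟨K, hK⟩)

theorem Mesh.size_pos (T : Mesh Ω) (hd : 0 < d) (hne : Ω.Nonempty) : 0 < T.size := by
  obtain ⟨x, hx⟩ := hne
  obtain ⟨K, hK, -⟩ := T.exists_mem hx
  have h1 : 1 < K.card := by rw [T.card_eq K hK]; omega
  obtain ⟨p, hp, r, hr, hpr⟩ := Finset.one_lt_card.1 h1
  exact (dist_pos.2 hpr).trans_le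
    (T.dist_le_size hK (subset_convexHull ℝ _ hp) (subset_convexHull ℝ _ hr))

theorem Mesh.size_le_diam (T : Mesh Ω) (hb : Bornology.IsBounded Ω) (hne : Ω.Nonempty) :
    T.size ≤ Metric.diam Ω := by
  obtain ⟨x, hx⟩ := hne
  obtain ⟨K, hK, -⟩ := T.exists_mem hx
  have : Nonempty T.elems := ⟨⟨K, hK⟩⟩
  refine ciSup_le fun L => ?_
  rw [← Metric.diam_closure Ω]
  exact Metric.diam_mono (T.subset_closure L.2) hb.closure

/-- Jensen's inequality for the distance of a number from an average. -/
theorem enorm_sub_average_sq_le {u : E d → ℂ} {B : Set (E d)} (hB0 : volume B ≠ 0)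
    (hB1 : volume B ≠ ⊤) (hu : IntegrableOn u B) (a : ℂ) :
    ‖a - ⨍ y in B, u y‖ₑ ^ 2 ≤ (volume B)⁻¹ * ∫⁻ y in B, ‖a - u y‖ₑ ^ 2 := by
  set ν : Measure (E d) := (volume B)⁻¹ • volume.restrict B with hν
  have hprob : IsProbabilityMeasure ν := ⟨by simp [hν, ENNReal.inv_mul_cancel hB0 hB1]⟩
  have hint : Integrable u ν := hu.smul_measure (ENNReal.inv_ne_top.2 hB0)
  have havg : ⨍ y in B, u y = ∫ y, u y ∂ν := by
    rw [average_eq', hν]; simp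
  have h1 : a - ⨍ y in B, u y = ∫ y, (a - u y) ∂ν := by
    rw [havg, integral_sub (integrable_const a) hint]; simp
  rw [h1]
  refine (enorm_integral_sq_le_lintegral
    ((integrable_const a).sub hint).aestronglyMeasurable).trans (le_of_eq ?_)
  rw [hν, lintegral_smul_measure, smul_eq_mul]
  rfl

/-- A Clément type quasi-interpolation of first order. The constant depends only on the size of `Ω` and
of a ball contained in it. -/
theorem exists_quasiInterpolant (hd : 0 < d) (ho : IsOpen Ω) (hc : Convex ℝ Ω)
    (hb : Bornology.IsBounded Ω) (hne : Ω.Nonempty) :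
    ∃ C : ℝ, 0 < C ∧ ∀ (T : Mesh Ω) (w : H1 Ω), ∃ v ∈ T.Vh,
      ‖toL2 w - toL2 v‖ ^ 2 ≤ (C * T.size) ^ 2 * ∑ i, ‖grad w i‖ ^ 2 := by
  obtain ⟨x₀, hx₀⟩ := hne
  obtain ⟨ρ, hρ, hball⟩ := Metric.nhds_basis_closedBall.mem_iff.1 (ho.mem_nhds hx₀)
  set D := Metric.diam Ω with hD
  refine ⟨2 * Real.sqrt ((2 * D / ρ) ^ d) + 1, by positivity, fun T w => ?_⟩
  set h := T.size with hh
  have hpos : 0 < h := T.size_pos hd ⟨x₀, hx₀⟩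
  have hhD : h ≤ D := T.size_le_diam hb ⟨x₀, hx₀⟩
  have hDpos : 0 < D := hpos.trans_le hhD
  set ε := h / D with hε
  have hε0 : 0 < ε := div_pos hpos hDpos
  have hε1 : ε ≤ 1 := (div_le_one hDpos).2 hhD
  have hεD : ε * D = h := div_mul_cancel₀ _ hDpos.ne'
  -- The image of the fixed ball under the homothety with centre `p` and ratio `ε`.
  set B : E d → Set (E d) := fun p => Metric.closedBall (p + ε • (x₀ - p)) (ε * ρ) with hB
  have hBsub : ∀ p ∈ closure Ω, ∀ y ∈ B p, y ∈ Ω ∧ dist y p ≤ h := by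
    intro p hp y hy
    set b := p + ε⁻¹ • (y - p) with hbdef
    have hyb : y = p + ε • (b - p) := by
      rw [hbdef, add_sub_cancel_left, smul_inv_smul₀ hε0.ne', add_sub_cancel]
    have hb' : b ∈ Metric.closedBall x₀ ρ := by
      rw [hB, mem_closedBall_iff_norm, hyb] at hy
      have : p + ε • (b - p) - (p + ε • (x₀ - p)) = ε • (b - x₀) := by module
      rw [this, norm_smul, Real.norm_of_nonneg hε0.le] at hy
      rw [mem_closedBall_iff_norm]
      exact le_of_mul_le_mul_left hy hε0
    constructor
    · have := hc.combo_closure_interior_mem_interior hp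
        (ho.interior_eq.symm ▸ hball hb' : b ∈ interior Ω) (sub_nonneg.2 hε1) hε0 (by ring)
      rw [ho.interior_eq] at this
      rw [hyb]
      convert this using 1
      module
    · rw [hyb, dist_eq_norm, add_sub_cancel_left, norm_smul, Real.norm_of_nonneg hε0.le, ← hεD]
      gcongr
      rw [← dist_eq_norm, hD, ← Metric.diam_closure]
      exact Metric.dist_le_diam_of_mem hb.closure (_root_.subset_closure (hball hb')) hp
  have hfin : IsFiniteMeasure ((volume : Measure (E d)).restrict Ω) :=
    ⟨by simpa using hb.measure_lt_top⟩
  have hwi : IntegrableOn (toL2 w) Ω := (Lp.memLp (toL2 w)).integrable (by norm_num)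
  set m := volume (Metric.closedBall (0 : E d) (ε * ρ)) with hm
  have hmB : ∀ p, volume (B p) = m := fun p => Measure.addHaar_closedBall_center _ _ _
  have hm0 : m ≠ 0 := (Metric.measure_closedBall_pos volume _ (by positivity)).ne'
  have hm1 : m ≠ ⊤ := measure_closedBall_lt_top.ne
  obtain ⟨v, hv, hvx⟩ := T.exists_nodal_interpolant ho hc hb fun p => ⨍ y in B p, toL2 w y
  refine ⟨v, hv, ?_⟩
  have hmain : ‖toL2 w - toL2 v‖ₑ ^ 2 ≤ m⁻¹ * (ENNReal.ofReal ((2 * h) ^ 2)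
      * volume (Metric.closedBall (0 : E d) (2 * h)) * ∑ i, ‖grad w i‖ₑ ^ 2) := by
    calc ‖toL2 w - toL2 v‖ₑ ^ 2 = ∫⁻ x in Ω, ‖toL2 w x - toL2 v x‖ₑ ^ 2 := by
          rw [L2.enorm_sq_eq_lintegral]
          refine lintegral_congr_ae ?_
          filter_upwards [Lp.coeFn_sub (toL2 w) (toL2 v)] with x hx
          rw [hx, Pi.sub_apply]
      _ ≤ ∫⁻ x in Ω, m⁻¹ * ∫⁻ y in Ω ∩ Metric.closedBall x (2 * h),
            ‖toL2 w x - toL2 w y‖ₑ ^ 2 := by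
          refine lintegral_mono_ae ?_
          filter_upwards [hvx] with x hx
          obtain ⟨K, hK, hxK, hle⟩ := hx
          obtain ⟨p, hp, hle⟩ := hle (toL2 w x)
          have hpK := subset_convexHull ℝ _ (Finset.mem_coe.2 hp)
          have hpc := T.subset_closure hK hpK
          calc ‖toL2 w x - toL2 v x‖ₑ ^ 2 ≤ ‖toL2 w x - ⨍ y in B p, toL2 w y‖ₑ ^ 2 := by
                gcongr
                exact enorm_le_iff_norm_le.2 hle
            _ ≤ m⁻¹ * ∫⁻ y in B p, ‖toL2 w x - toL2 w y‖ₑ ^ 2 := by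
                rw [← hmB p]
                refine enorm_sub_average_sq_le (by rwa [hmB]) (by rwa [hmB]) ?_ _
                exact hwi.mono_set fun y hy => (hBsub p hpc y hy).1
            _ ≤ _ := by
                gcongr
                refine fun y hy => ?_
                refine ⟨(hBsub p hpc y hy).1, ?_⟩
                have h1 := (hBsub p hpc y hy).2
                have h2 := T.dist_le_size hK hpK hxK
                have h3 := dist_triangle y p x
                simp only [Metric.mem_closedBall]
                linarith
      _ ≤ _ := by
          rw [lintegral_const_mul' _ _ (ENNReal.inv_ne_top.2 hm0)]
          gcongr
          exact lintegral_lintegral_sub_le ho hc hb w (by positivity)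
  -- The powers of `h` in the two volumes cancel.
  have hvol : m⁻¹ * volume (Metric.closedBall (0 : E d) (2 * h))
      = ENNReal.ofReal ((2 * D / ρ) ^ d) := by
    rw [hm, Measure.addHaar_closedBall _ _ (by positivity),
      Measure.addHaar_closedBall _ _ (by positivity)]
    have hb0 : volume (Metric.ball (0 : E d) 1) ≠ 0 := (Metric.measure_ball_pos _ _ one_pos).ne'
    have hb1 : volume (Metric.ball (0 : E d) 1) ≠ ⊤ := measure_ball_lt_top.ne
    rw [mul_comm, ← div_eq_mul_inv, ENNReal.mul_div_mul_right _ _ hb0 hb1,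
      ← ENNReal.ofReal_div_of_pos (by positivity), ← div_pow]
    congr 2
    · rw [hε]; field_simp
    · exact finrank_euclideanSpace_fin
  have hreal : ‖toL2 w - toL2 v‖ ^ 2 ≤ (2 * h) ^ 2 * (2 * D / ρ) ^ d * ∑ i, ‖grad w i‖ ^ 2 := by
    have h1 : m⁻¹ * (ENNReal.ofReal ((2 * h) ^ 2)
      * volume (Metric.closedBall (0 : E d) (2 * h)) * ∑ i, ‖grad w i‖ₑ ^ 2)
      = ENNReal.ofReal ((2 * h) ^ 2 * (2 * D / ρ) ^ d * ∑ i, ‖grad w i‖ ^ 2) := by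
      rw [ENNReal.ofReal_mul (by positivity), ENNReal.ofReal_mul (by positivity), ← hvol,
        ENNReal.ofReal_sum_of_nonneg fun i _ => by positivity]
      simp only [ENNReal.ofReal_pow (norm_nonneg _), ofReal_norm]
      ring
    rw [h1, ← ofReal_norm, ← ENNReal.ofReal_pow (norm_nonneg _)] at hmain
    exact (ENNReal.ofReal_le_ofReal_iff (by positivity)).1 hmain
  refine hreal.trans ?_
  gcongr
  have hs : Real.sqrt ((2 * D / ρ) ^ d) ^ 2 = (2 * D / ρ) ^ d := Real.sq_sqrt (by positivity)
  calc (2 * h) ^ 2 * (2 * D / ρ) ^ d = (2 * Real.sqrt ((2 * D / ρ) ^ d) * h) ^ 2 := by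
        rw [mul_pow, mul_pow, mul_pow, hs]; ring
    _ ≤ _ := by gcongr; linarith

/-! ### The finite element space -/

theorem Mesh.volume_inter_eq_zero (T : Mesh Ω) {K L : Finset (E d)} (hK : K ∈ T.elems)
    (hL : L ∈ T.elems) (hKL : K ≠ L) :
    volume (convexHull ℝ (K : Set (E d)) ∩ convexHull ℝ (L : Set (E d))) = 0 := by
  classical
  have hlt : (K ∩ L).card < d + 1 := by
    rw [← T.card_eq K hK]
    refine Finset.card_lt_card (Finset.ssubset_iff_subset_ne.2 ⟨Finset.inter_subset_left, ?_⟩)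
    intro h
    exact hKL (Finset.eq_of_subset_of_card_le (Finset.inter_eq_left.1 h)
      (by rw [T.card_eq K hK, T.card_eq L hL]))
  have hind : AffineIndependent ℝ ((↑) : (K ∩ L : Finset (E d)) → E d) :=
    AffineIndependent.mono (s := ((K ∩ L : Finset (E d)) : Set (E d))) (t := (K : Set (E d)))
      (T.indep K hK) (by simp)
  have hne : affineSpan ℝ ((K : Set (E d)) ∩ L) ≠ ⊤ := by
    intro h
    have h' : affineSpan ℝ (range ((↑) : (K ∩ L : Finset (E d)) → E d)) = ⊤ := by
      rw [← h]; congr 1; ext x; simp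
    rw [hind.affineSpan_eq_top_iff_card_eq_finrank_add_one] at h'
    simp only [Fintype.card_coe, finrank_euclideanSpace_fin] at h'
    omega
  exact measure_mono_null ((T.conforming K hK L hL).trans (convexHull_subset_affineSpan _))
    (Measure.addHaar_affineSubspace _ _ hne)

theorem Mesh.ae_unique (T : Mesh Ω) : ∀ᵐ x : E d, ∀ K ∈ T.elems, ∀ L ∈ T.elems,
    x ∈ convexHull ℝ (K : Set (E d)) → x ∈ convexHull ℝ (L : Set (E d)) → K = L := by
  rw [Filter.eventually_all_finset]
  intro K hK
  rw [Filter.eventually_all_finset]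
  intro L hL
  by_cases h : K = L
  · simp [h]
  · have := T.volume_inter_eq_zero hK hL h
    rw [measure_eq_zero_iff_ae_notMem] at this
    filter_upwards [this] with x hx h1 h2
    exact absurd ⟨h1, h2⟩ hx

/-- Almost every point of `Ω` is in exactly one element, the same for every family `f`. -/
theorem Mesh.sum_indicator_ae_eq (T : Mesh Ω) (ho : IsOpen Ω) {M : Type*} [AddCommMonoid M] :
    ∀ᵐ x ∂(volume : Measure (E d)).restrict Ω, ∀ f : Finset (E d) → E d → M, ∃ K ∈ T.elems,
      x ∈ convexHull ℝ (K : Set (E d)) ∧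
      ∑ L ∈ T.elems, (convexHull ℝ (L : Set (E d))).indicator (f L) x = f K x := by
  filter_upwards [ae_restrict_mem ho.measurableSet, ae_restrict_of_ae T.ae_unique] with x hx hu f
  obtain ⟨K, hK, hxK⟩ := T.exists_mem hx
  refine ⟨K, hK, hxK, ?_⟩
  rw [Finset.sum_eq_single_of_mem K hK, indicator_of_mem hxK]
  intro L hL hLK
  exact indicator_of_notMem (fun h => hLK (hu L hL K hK h hxK)) _

theorem Mesh.sum_setIntegral (T : Mesh Ω) (ho : IsOpen Ω) {f : E d → ℂ} (hf : IntegrableOn f Ω) :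
    ∑ K ∈ T.elems, ∫ x in Ω ∩ convexHull ℝ (K : Set (E d)), f x = ∫ x in Ω, f x := by
  have hm : ∀ K : Finset (E d), MeasurableSet (convexHull ℝ (K : Set (E d))) := fun K =>
    (isCompact_convexHull_finset K).isClosed.measurableSet
  have h1 : ∀ K ∈ T.elems, ∫ x in Ω ∩ convexHull ℝ (K : Set (E d)), f x
      = ∫ x in Ω, (convexHull ℝ (K : Set (E d))).indicator f x := fun K _ =>
    (setIntegral_indicator (hm K)).symm
  rw [Finset.sum_congr rfl h1, ← integral_finsetSum _ fun K _ => hf.indicator (hm K)]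
  refine integral_congr_ae ?_
  filter_upwards [T.sum_indicator_ae_eq ho (M := ℂ)] with x hx
  obtain ⟨K, hK, hxK, h⟩ := hx fun _ => f
  exact h

/-- `V_h` as a real vector space. -/
def Mesh.VhSubmodule (T : Mesh Ω) : Submodule ℝ (H1 Ω) where
  carrier := T.Vh
  add_mem' := by
    intro u v hu hv K hK
    obtain ⟨a, b, h⟩ := hu K hK
    obtain ⟨a', b', h'⟩ := hv K hK
    refine ⟨a + a', b + b', ?_⟩
    filter_upwards [h, h', Lp.coeFn_add (toL2 u) (toL2 v)] with x hx hx' hadd hxK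
    have : toL2 (u + v) = toL2 u + toL2 v := rfl
    rw [this, hadd, Pi.add_apply, hx hxK, hx' hxK]
    simp only [Pi.add_apply, add_mul, Finset.sum_add_distrib]
    ring
  zero_mem' := by
    intro K hK
    refine ⟨0, 0, ?_⟩
    filter_upwards [Lp.coeFn_zero ℂ 2 ((volume : Measure (E d)).restrict Ω)] with x hx hxK
    have : toL2 (0 : H1 Ω) = 0 := rfl
    rw [this, hx]
    simp
  smul_mem' := by
    intro c v hv K hK
    obtain ⟨a, b, h⟩ := hv K hK
    refine ⟨c * a, fun i => c * b i, ?_⟩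
    filter_upwards [h, Lp.coeFn_smul c (toL2 v)] with x hx hc hxK
    have : toL2 (c • v) = c • toL2 v := rfl
    rw [this, hc, Pi.smul_apply, hx hxK]
    simp [Finset.mul_sum, mul_assoc]



/-- `toL2` as a linear map. -/
def toL2Lin : H1 Ω →ₗ[ℝ] L2 Ω := LinearMap.fst ℝ _ _ ∘ₗ (H1 Ω).subtype

theorem toL2Lin_apply (v : H1 Ω) : toL2Lin v = toL2 v := rfl

/-- The sum over the elements `K` of the affine functions with coefficients `c K`, cut off outside `K`.
-/
def Mesh.piecewiseAffine (T : Mesh Ω) (c : Finset (E d) → ℂ × (Fin d → ℂ)) (x : E d) : ℂ :=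
  ∑ K ∈ T.elems, (convexHull ℝ (K : Set (E d))).indicator
    (fun x => (c K).1 + ∑ i, (c K).2 i * (x i : ℂ)) x

theorem Mesh.memLp_piecewiseAffine (T : Mesh Ω) (c : Finset (E d) → ℂ × (Fin d → ℂ)) :
    MemLp (T.piecewiseAffine c) 2 ((volume : Measure (E d)).restrict Ω) := by
  refine memLp_finsetSum _ fun K _ => ?_
  have hcpt := isCompact_convexHull_finset K
  have hcont : Continuous fun x : E d => (c K).1 + ∑ i, (c K).2 i * (x i : ℂ) := by fun_prop
  refine MemLp.restrict Ω ?_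
  rw [memLp_indicator_iff_restrict hcpt.isClosed.measurableSet]
  have : IsFiniteMeasure (volume.restrict (convexHull ℝ (K : Set (E d)))) :=
    ⟨by simpa using hcpt.measure_lt_top⟩
  obtain ⟨B, hB⟩ := hcpt.exists_bound_of_continuousOn hcont.continuousOn
  refine MemLp.of_bound hcont.aestronglyMeasurable B ?_
  rw [ae_restrict_iff' hcpt.isClosed.measurableSet]
  exact .of_forall hB

/-- `Mesh.piecewiseAffine` as a linear map from coefficients to `L²(Ω)`. Its range is a finite
dimensional space which contains `V_h`. -/
def Mesh.piecewiseAffineLin (T : Mesh Ω) : (T.elems → ℂ × (Fin d → ℂ)) →ₗ[ℝ] L2 Ω where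
  toFun c := (T.memLp_piecewiseAffine fun K => if h : K ∈ T.elems then c ⟨K, h⟩ else 0).toLp
  map_add' c c' := by
    rw [← MemLp.toLp_add]
    congr 1
    ext x
    simp only [Mesh.piecewiseAffine, Pi.add_apply, ← Finset.sum_add_distrib]
    refine Finset.sum_congr rfl fun K hK => ?_
    by_cases hx : x ∈ convexHull ℝ (K : Set (E d))
    · simp only [indicator_of_mem hx, dif_pos hK, Prod.fst_add, Prod.snd_add, Pi.add_apply, add_mul,
        Finset.sum_add_distrib]
      ring
    · simp [indicator_of_notMem hx]
  map_smul' r c := by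
    rw [RingHom.id_apply, ← MemLp.toLp_const_smul]
    congr 1
    ext x
    simp only [Mesh.piecewiseAffine, Pi.smul_apply, Finset.smul_sum]
    refine Finset.sum_congr rfl fun K hK => ?_
    by_cases hx : x ∈ convexHull ℝ (K : Set (E d))
    · simp [indicator_of_mem hx, dif_pos hK, Finset.mul_sum, mul_assoc]
    · simp [indicator_of_notMem hx]

theorem Mesh.finiteDimensional_map_toL2 (T : Mesh Ω) (ho : IsOpen Ω) :
    FiniteDimensional ℝ (T.VhSubmodule.map toL2Lin) := by
  have hle : T.VhSubmodule.map toL2Lin ≤ LinearMap.range T.piecewiseAffineLin := by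
    rintro _ ⟨v, hv, rfl⟩
    have hv' : ∀ K : T.elems, ∃ (c : ℂ × (Fin d → ℂ)),
        ∀ᵐ x ∂((volume : Measure (E d)).restrict Ω), x ∈ convexHull ℝ (K.1 : Set (E d)) →
          toL2 v x = c.1 + ∑ i, c.2 i * (x i : ℂ) := fun K => by
      obtain ⟨a, b, h⟩ := hv K.1 K.2
      exact ⟨(a, b), h⟩
    choose c hc using hv'
    refine ⟨c, Lp.ext ?_⟩
    filter_upwards [MemLp.coeFn_toLp (T.memLp_piecewiseAffine fun K =>
        if h : K ∈ T.elems then c ⟨K, h⟩ else 0), T.sum_indicator_ae_eq ho (M := ℂ),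
      Filter.eventually_all.2 hc] with x hx hs hcx
    refine hx.trans ?_
    obtain ⟨K, hK, hxK, he⟩ := hs fun K x => ((if h : K ∈ T.elems then c ⟨K, h⟩ else 0) :
      ℂ × (Fin d → ℂ)).1 + ∑ i, ((if h : K ∈ T.elems then c ⟨K, h⟩ else 0) :
      ℂ × (Fin d → ℂ)).2 i * (x i : ℂ)
    refine he.trans ?_
    rw [toL2Lin_apply, hcx ⟨K, hK⟩ hxK]
    simp only [dif_pos hK]
  exact Submodule.finiteDimensional_of_le hle

/-- A function has at most one weak gradient. -/
theorem toL2_injective (ho : IsOpen Ω) : Function.Injective (toL2Lin : H1 Ω →ₗ[ℝ] L2 Ω) := by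
  rw [← LinearMap.ker_eq_bot, LinearMap.ker_eq_bot']
  intro v hv
  have hv0 : toL2 v = 0 := hv
  have hg : ∀ i, grad v i = 0 := by
    intro i
    have hloc : LocallyIntegrableOn (grad v i) Ω := by
      have : LocallyIntegrable (grad v i) ((volume : Measure (E d)).restrict Ω) :=
        (Lp.memLp (grad v i)).locallyIntegrable (by norm_num)
      exact locallyIntegrableOn_of_locallyIntegrable_restrict this
    have h := ho.ae_eq_zero_of_integral_contDiff_smul_eq_zero hloc fun φ h1 h2 h3 => by
      have hφ : IsTestFunction Ω φ := ⟨h1, h2, h3⟩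
      have h4 := isWeakGrad v φ hφ i
      rw [hv0, integral_zero_mul, eq_comm, neg_eq_zero] at h4
      rw [← setIntegral_eq_integral_of_forall_compl_eq_zero (s := Ω), ← h4]
      · congr 1; ext x; simp [mul_comm]
      · intro x hx
        rw [image_eq_zero_of_notMem_tsupport fun h => hx (h3 h), zero_smul]
    refine Lp.ext ?_
    filter_upwards [Lp.coeFn_zero ℂ 2 ((volume : Measure (E d)).restrict Ω), ae_restrict_of_ae h,
      ae_restrict_mem ho.measurableSet] with x h0 hx hxΩ
    rw [h0, hx hxΩ]; rfl
  exact Subtype.ext (Prod.ext hv0 (funext hg))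

/-! ### The bilinear forms on a Hilbert space -/

/-- `L²` vector fields on `Ω`, with the Hilbert space norm. -/
abbrev GradSpace (Ω : Set (E d)) : Type := PiLp 2 (fun _ : Fin d => L2 Ω)

/-- The Hilbert space of pairs of an `L²` function and an `L²` vector field, which contains `H¹(Ω)` as
the closed subspace of the pairs `(v, ∇v)`. The type `H1 Ω` itself carries the supremum norm of a
product, for which the Lax–Milgram theorem is not available. -/
abbrev Ambient (Ω : Set (E d)) : Type := WithLp 2 (L2 Ω × GradSpace Ω)

/-- The embedding `v ↦ (v, ∇v)` of `H¹(Ω)` into the Hilbert space `Ambient Ω`. -/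
def toAmbient : H1 Ω →ₗ[ℝ] Ambient Ω :=
  (WithLp.linearEquiv 2 ℝ (L2 Ω × GradSpace Ω)).symm.toLinearMap ∘ₗ
    (LinearMap.id.prodMap (WithLp.linearEquiv 2 ℝ (Fin d → L2 Ω)).symm.toLinearMap) ∘ₗ
    (H1 Ω).subtype

@[simp] theorem toAmbient_fst (v : H1 Ω) : (toAmbient v).fst = toL2 v := rfl

@[simp] theorem toAmbient_snd_apply (v : H1 Ω) (i : Fin d) : (toAmbient v).snd i = grad v i := rfl

theorem norm_toAmbient_snd_sq (v : H1 Ω) : ‖(toAmbient v).snd‖ ^ 2 = ∑ i, ‖grad v i‖ ^ 2 := by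
  rw [PiLp.norm_sq_eq_of_L2]; simp

theorem norm_toAmbient_sq (v : H1 Ω) :
    ‖toAmbient v‖ ^ 2 = ‖toL2 v‖ ^ 2 + ‖(toAmbient v).snd‖ ^ 2 := by
  rw [WithLp.prod_norm_sq_eq_of_L2]; simp

theorem toAmbient_injective : Function.Injective (toAmbient : H1 Ω →ₗ[ℝ] Ambient Ω) := by
  intro v w h
  refine Subtype.ext (Prod.ext ?_ (funext fun i => ?_))
  · exact congrArg WithLp.fst h
  · exact congrArg (fun x : Ambient Ω => x.snd i) h

theorem continuous_integral_mul {ψ : E d → ℝ}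
    (hψ : MemLp (fun x => (ψ x : ℂ)) 2 ((volume : Measure (E d)).restrict Ω)) :
    Continuous fun u : L2 Ω => ∫ x in Ω, u x * (ψ x : ℂ) := by
  have : (fun u : L2 Ω => ∫ x in Ω, u x * (ψ x : ℂ)) = fun u => inner ℂ hψ.toLp u := by
    ext u
    rw [L2.inner_def]
    refine integral_congr_ae ?_
    filter_upwards [hψ.coeFn_toLp] with x hx
    rw [hx]
    simp
  rw [this]
  fun_prop

theorem isClosed_range_toAmbient :
    IsClosed (LinearMap.range (toAmbient : H1 Ω →ₗ[ℝ] Ambient Ω) : Set (Ambient Ω)) := by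
  have : (LinearMap.range (toAmbient : H1 Ω →ₗ[ℝ] Ambient Ω) : Set (Ambient Ω))
      = {x | IsWeakGrad Ω x.fst fun i => x.snd i} := by
    ext x
    constructor
    · rintro ⟨v, rfl⟩
      exact isWeakGrad v
    · intro hx
      exact ⟨⟨(x.fst, fun i => x.snd i), hx⟩, rfl⟩
  rw [this]
  simp only [IsWeakGrad, Set.ofPred_forall]
  refine isClosed_iInter fun φ => isClosed_iInter fun hφ => isClosed_iInter fun i => ?_
  refine isClosed_eq ?_ ?_
  · exact (continuous_integral_mul (hφ.memLp_partialDeriv i)).comp (by fun_prop)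
  · exact ((continuous_integral_mul hφ.memLp).comp
      (show Continuous fun x : Ambient Ω => x.snd i by fun_prop)).neg

theorem memLp_ofReal_mul {m : E d → ℝ} (hm : MemLp m ⊤ ((volume : Measure (E d)).restrict Ω))
    (u : L2 Ω) : MemLp (fun x => (m x : ℂ) * u x) 2 ((volume : Measure (E d)).restrict Ω) := by
  have h : MemLp (fun x => m x • u x) 2 ((volume : Measure (E d)).restrict Ω) :=
    (Lp.memLp u).smul hm
  simpa using h

theorem eLpNorm_ofReal_mul_le {m : E d → ℝ}
    (hm : MemLp m ⊤ ((volume : Measure (E d)).restrict Ω)) (u : L2 Ω) :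
    eLpNorm (fun x => (m x : ℂ) * u x) 2 ((volume : Measure (E d)).restrict Ω)
      ≤ eLpNorm m ⊤ ((volume : Measure (E d)).restrict Ω)
        * eLpNorm u 2 ((volume : Measure (E d)).restrict Ω) := by
  have h := eLpNorm_smul_le_mul_eLpNorm (p := ⊤) (q := 2) (r := 2) (Lp.aestronglyMeasurable u) hm.1
  have he : (fun x => (m x : ℂ) * u x) = m • (u : E d → ℂ) := by
    ext x
    rw [Pi.smul_apply', Complex.real_smul]
  rw [he]
  exact h

/-- Multiplication by a bounded real function, as a linear map on `L²(Ω)`. -/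
def mulL2Lin (m : E d → ℝ) (hm : MemLp m ⊤ ((volume : Measure (E d)).restrict Ω)) :
    L2 Ω →ₗ[ℝ] L2 Ω where
  toFun u := (memLp_ofReal_mul hm u).toLp
  map_add' u v := by
    refine Lp.ext ?_
    filter_upwards [Lp.coeFn_add u v, (memLp_ofReal_mul hm (u + v)).coeFn_toLp,
      (memLp_ofReal_mul hm u).coeFn_toLp, (memLp_ofReal_mul hm v).coeFn_toLp,
      Lp.coeFn_add (memLp_ofReal_mul hm u).toLp (memLp_ofReal_mul hm v).toLp] with x h1 h2 h3 h4 h5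
    rw [h2, h5, Pi.add_apply, h3, h4, h1, Pi.add_apply, mul_add]
  map_smul' c u := by
    refine Lp.ext ?_
    filter_upwards [Lp.coeFn_smul c u, (memLp_ofReal_mul hm (c • u)).coeFn_toLp,
      (memLp_ofReal_mul hm u).coeFn_toLp,
      Lp.coeFn_smul c (memLp_ofReal_mul hm u).toLp] with x h1 h2 h3 h4
    rw [h2, RingHom.id_apply, h4, Pi.smul_apply, h3, h1, Pi.smul_apply, mul_smul_comm]

theorem norm_mulL2Lin_le (m : E d → ℝ) (hm : MemLp m ⊤ ((volume : Measure (E d)).restrict Ω))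
    (u : L2 Ω) : ‖mulL2Lin m hm u‖
      ≤ (eLpNorm m ⊤ ((volume : Measure (E d)).restrict Ω)).toReal * ‖u‖ := by
  have h : ‖mulL2Lin m hm u‖ = (eLpNorm (fun x => (m x : ℂ) * u x) 2
      ((volume : Measure (E d)).restrict Ω)).toReal :=
    Lp.norm_toLp _ (memLp_ofReal_mul hm u)
  rw [h, Lp.norm_def, ← ENNReal.toReal_mul]
  exact ENNReal.toReal_mono (ENNReal.mul_ne_top hm.2.ne (Lp.memLp u).2.ne)
    (eLpNorm_ofReal_mul_le hm u)

/-- Multiplication by a bounded real function, as a bounded operator on `L²(Ω)`. -/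
def mulL2 (m : E d → ℝ) (hm : MemLp m ⊤ ((volume : Measure (E d)).restrict Ω)) :
    L2 Ω →L[ℝ] L2 Ω :=
  (mulL2Lin m hm).mkContinuous _ (norm_mulL2Lin_le m hm)

theorem mulL2_ae (m : E d → ℝ) (hm : MemLp m ⊤ ((volume : Measure (E d)).restrict Ω)) (u : L2 Ω) :
    ∀ᵐ x ∂(volume : Measure (E d)).restrict Ω, mulL2 m hm u x = (m x : ℂ) * u x :=
  (memLp_ofReal_mul hm u).coeFn_toLp

theorem l2Inner_eq_inner {u v : E d → ℂ} {a b : L2 Ω}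
    (ha : ∀ᵐ x ∂(volume : Measure (E d)).restrict Ω, u x = a x)
    (hb : ∀ᵐ x ∂(volume : Measure (E d)).restrict Ω, v x = b x) :
    l2Inner Ω u v = inner ℝ a b := by
  have h1 : ∫ x in Ω, u x * (starRingEnd ℂ) (v x) = inner ℂ b a := by
    rw [L2.inner_def]
    refine integral_congr_ae ?_
    filter_upwards [ha, hb] with x hx hx'
    rw [hx, hx']; simp
  have h2 : Integrable (fun x => inner ℂ (b x) (a x)) ((volume : Measure (E d)).restrict Ω) :=
    L2.integrable_inner b a
  rw [l2Inner, h1, L2.inner_def, L2.inner_def]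
  refine (integral_re h2).symm.trans ?_
  congr 1; ext x
  simp [Complex.inner, mul_comm]

theorem l2Inner_inter {S : Set (E d)} (hS : MeasurableSet S) (u v : E d → ℂ) :
    l2Inner (Ω ∩ S) u v = l2Inner Ω (fun x => ((S.indicator 1 x : ℝ) : ℂ) * u x) v := by
  rw [l2Inner, l2Inner, ← setIntegral_indicator hS]
  congr 2; ext x
  by_cases hx : x ∈ S <;> simp [hx]

theorem norm_sq_eq_integral (u : L2 Ω) : ‖u‖ ^ 2 = ∫ x in Ω, ‖u x‖ ^ 2 := by
  rw [← real_inner_self_eq_norm_sq, L2.inner_def]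
  simp only [real_inner_self_eq_norm_sq]

theorem integrable_norm_sq (u : L2 Ω) :
    Integrable (fun x => ‖u x‖ ^ 2) ((volume : Measure (E d)).restrict Ω) :=
  (Lp.memLp u).integrable_norm_pow (by norm_num)

theorem memLp_apply {A : E d → E d} (hA : MemLp A ⊤ ((volume : Measure (E d)).restrict Ω))
    (i : Fin d) : MemLp (fun x => A x i) ⊤ ((volume : Measure (E d)).restrict Ω) :=
  (EuclideanSpace.proj (𝕜 := ℝ) i).comp_memLp' hA

/-- The operator `u ↦ A u` from functions to vector fields. -/
def mulField (A : E d → E d) (hA : MemLp A ⊤ ((volume : Measure (E d)).restrict Ω)) :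
    L2 Ω →L[ℝ] GradSpace Ω :=
  (PiLp.continuousLinearEquiv 2 ℝ fun _ : Fin d => L2 Ω).symm.toContinuousLinearMap ∘L
    ContinuousLinearMap.pi fun i => mulL2 (fun x => A x i) (memLp_apply hA i)

theorem mulField_apply (A : E d → E d) (hA : MemLp A ⊤ ((volume : Measure (E d)).restrict Ω))
    (u : L2 Ω) (i : Fin d) : mulField A hA u i = mulL2 (fun x => A x i) (memLp_apply hA i) u := rfl

theorem supNorm_nonneg (A : E d → E d) : 0 ≤ supNorm Ω A := ENNReal.toReal_nonneg

theorem ae_norm_le_supNorm {A : E d → E d} (hA : MemLp A ⊤ ((volume : Measure (E d)).restrict Ω)) :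
    ∀ᵐ x ∂(volume : Measure (E d)).restrict Ω, ‖A x‖ ≤ supNorm Ω A := by
  have h := ae_le_eLpNormEssSup (f := A) (μ := (volume : Measure (E d)).restrict Ω)
  filter_upwards [h] with x hx
  rw [supNorm, ← toReal_enorm]
  refine ENNReal.toReal_mono hA.2.ne ?_
  rwa [eLpNorm_exponent_top]

theorem norm_mulField_le {A : E d → E d} (hA : MemLp A ⊤ ((volume : Measure (E d)).restrict Ω))
    (u : L2 Ω) : ‖mulField A hA u‖ ≤ supNorm Ω A * ‖u‖ := by
  refine le_of_sq_le_sq ?_ (mul_nonneg (supNorm_nonneg A) (norm_nonneg u))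
  rw [PiLp.norm_sq_eq_of_L2, mul_pow]
  simp only [norm_sq_eq_integral]
  rw [← integral_finsetSum _ fun i _ => integrable_norm_sq _, ← integral_const_mul]
  refine integral_mono_ae (integrable_finsetSum _ fun i _ => integrable_norm_sq _)
    ((integrable_norm_sq u).const_mul _) ?_
  filter_upwards [ae_norm_le_supNorm hA,
    Filter.eventually_all.2 fun i => mulL2_ae (fun x => A x i) (memLp_apply hA i) u] with x hx hm
  have : ∑ i, ‖mulField A hA u i x‖ ^ 2 = ‖A x‖ ^ 2 * ‖u x‖ ^ 2 := by
    rw [EuclideanSpace.norm_sq_eq, Finset.sum_mul]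
    refine Finset.sum_congr rfl fun i _ => ?_
    rw [mulField_apply, hm i, norm_mul, mul_pow]
    simp
  simp only [this]
  gcongr

/-- The magnetic gradient `(i/κ) ∇ + A`, extended to all pairs `(v, g)` as `(i/κ) g + A v`. -/
def magGradOp (A : E d → E d) (hA : MemLp A ⊤ ((volume : Measure (E d)).restrict Ω)) (κ : ℝ) :
    Ambient Ω →L[ℝ] GradSpace Ω :=
  ((Complex.I / (κ : ℂ)) • ContinuousLinearMap.id ℂ (GradSpace Ω)).restrictScalars ℝ ∘L
    WithLp.sndL 2 ℝ (L2 Ω) (GradSpace Ω) + mulField A hA ∘L WithLp.fstL 2 ℝ (L2 Ω) (GradSpace Ω)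

theorem magGradOp_apply (A : E d → E d) (hA : MemLp A ⊤ ((volume : Measure (E d)).restrict Ω))
    (κ : ℝ) (x : Ambient Ω) :
    magGradOp A hA κ x = (Complex.I / (κ : ℂ)) • x.snd + mulField A hA x.fst := rfl

theorem magGrad_ae (A : E d → E d) (hA : MemLp A ⊤ ((volume : Measure (E d)).restrict Ω)) (κ : ℝ)
    (v : H1 Ω) (i : Fin d) : ∀ᵐ x ∂(volume : Measure (E d)).restrict Ω,
      magGrad A κ v i x = magGradOp A hA κ (toAmbient v) i x := by
  have h : magGradOp A hA κ (toAmbient v) i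
      = (Complex.I / (κ : ℂ)) • grad v i + mulL2 (fun x => A x i) (memLp_apply hA i) (toL2 v) := rfl
  rw [h]
  filter_upwards [Lp.coeFn_add ((Complex.I / (κ : ℂ)) • grad v i)
      (mulL2 (fun x => A x i) (memLp_apply hA i) (toL2 v)),
    Lp.coeFn_smul (Complex.I / (κ : ℂ)) (grad v i),
    mulL2_ae (fun x => A x i) (memLp_apply hA i) (toL2 v)] with x h1 h2 h3
  rw [h1, Pi.add_apply, h2, h3, Pi.smul_apply, magGrad, smul_eq_mul]

/-- The form `a_β` as a bounded bilinear form on `Ambient Ω`. -/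
def formOp (A : E d → E d) (hA : MemLp A ⊤ ((volume : Measure (E d)).restrict Ω)) (κ β : ℝ) :
    Ambient Ω →L[ℝ] Ambient Ω →L[ℝ] ℝ :=
  (innerSL ℝ).bilinearComp (magGradOp A hA κ) (magGradOp A hA κ)
    + β • (innerSL ℝ).bilinearComp (WithLp.fstL 2 ℝ (L2 Ω) (GradSpace Ω))
      (WithLp.fstL 2 ℝ (L2 Ω) (GradSpace Ω))

theorem formOp_apply (A : E d → E d) (hA : MemLp A ⊤ ((volume : Measure (E d)).restrict Ω))
    (κ β : ℝ) (x y : Ambient Ω) : formOp A hA κ β x y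
      = inner ℝ (magGradOp A hA κ x) (magGradOp A hA κ y) + β * inner ℝ x.fst y.fst := rfl

theorem aForm_eq_formOp (A : E d → E d) (hA : MemLp A ⊤ ((volume : Measure (E d)).restrict Ω))
    (κ β : ℝ) (v w : H1 Ω) :
    aForm A κ β v w = formOp A hA κ β (toAmbient v) (toAmbient w) := by
  rw [formOp_apply, PiLp.inner_apply, aForm, aFormOn]
  congr 1
  · exact Finset.sum_congr rfl fun i _ =>
      l2Inner_eq_inner (magGrad_ae A hA κ v i) (magGrad_ae A hA κ w i)
  · rw [l2Inner_eq_inner (a := toL2 v) (b := toL2 w) (.of_forall fun _ => rfl)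
      (.of_forall fun _ => rfl)]
    rfl

theorem exists_aFormOn_eq (A : E d → E d) (hA : MemLp A ⊤ ((volume : Measure (E d)).restrict Ω))
    (κ β : ℝ) {S : Set (E d)} (hS : MeasurableSet S) (v : H1 Ω) :
    ∃ ℓ : Ambient Ω →L[ℝ] ℝ, ∀ w : H1 Ω, aFormOn A κ β (Ω ∩ S) v w = ℓ (toAmbient w) := by
  have hm : MemLp (S.indicator (1 : E d → ℝ)) ⊤ ((volume : Measure (E d)).restrict Ω) :=
    (memLp_top_const (1 : ℝ)).indicator hS
  refine ⟨∑ i, (innerSL ℝ (mulL2 _ hm (magGradOp A hA κ (toAmbient v) i))) ∘L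
      (PiLp.proj 2 (fun _ : Fin d => L2 Ω) i : _ →L[ℝ] _) ∘L magGradOp A hA κ
    + β • (innerSL ℝ (mulL2 _ hm (toL2 v))) ∘L WithLp.fstL 2 ℝ (L2 Ω) (GradSpace Ω), fun w => ?_⟩
  have key : ∀ (f g : E d → ℂ) (a b : L2 Ω),
      (∀ᵐ x ∂(volume : Measure (E d)).restrict Ω, f x = a x) →
      (∀ᵐ x ∂(volume : Measure (E d)).restrict Ω, g x = b x) →
      l2Inner (Ω ∩ S) f g = inner ℝ (mulL2 _ hm a) b := by
    intro f g a b ha hb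
    rw [l2Inner_inter hS]
    refine l2Inner_eq_inner ?_ hb
    filter_upwards [ha, mulL2_ae _ hm a] with x h1 h2
    rw [h1, h2]
  rw [aFormOn]
  simp only [add_apply, sum_apply]
  congr 1
  · exact Finset.sum_congr rfl fun i _ => key _ _ _ _ (magGrad_ae A hA κ v i) (magGrad_ae A hA κ w i)
  · rw [key _ _ (toL2 v) (toL2 w) (.of_forall fun _ => rfl) (.of_forall fun _ => rfl)]
    rfl

theorem Mesh.sum_l2Inner (T : Mesh Ω) (ho : IsOpen Ω) {u v : E d → ℂ} {a b : L2 Ω}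
    (ha : ∀ᵐ x ∂(volume : Measure (E d)).restrict Ω, u x = a x)
    (hb : ∀ᵐ x ∂(volume : Measure (E d)).restrict Ω, v x = b x) :
    ∑ K ∈ T.elems, l2Inner (Ω ∩ convexHull ℝ (K : Set (E d))) u v = l2Inner Ω u v := by
  have hint : IntegrableOn (fun x => u x * (starRingEnd ℂ) (v x)) Ω := by
    refine (L2.integrable_inner (𝕜 := ℂ) b a).congr ?_
    filter_upwards [ha, hb] with x hx hx'
    rw [hx, hx']; simp
  simp only [l2Inner]
  rw [← Complex.re_sum, T.sum_setIntegral ho hint]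

theorem Mesh.sum_aFormOn (T : Mesh Ω) (ho : IsOpen Ω) (A : E d → E d)
    (hA : MemLp A ⊤ ((volume : Measure (E d)).restrict Ω)) (κ β : ℝ) (v w : H1 Ω) :
    ∑ K ∈ T.elems, aFormOn A κ β (Ω ∩ convexHull ℝ (K : Set (E d))) v w = aForm A κ β v w := by
  simp only [aForm, aFormOn, Finset.sum_add_distrib, ← Finset.mul_sum]
  rw [Finset.sum_comm]
  congr 1
  · exact Finset.sum_congr rfl fun i _ =>
      T.sum_l2Inner ho (magGrad_ae A hA κ v i) (magGrad_ae A hA κ w i)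
  · rw [T.sum_l2Inner ho (a := toL2 v) (b := toL2 w) (.of_forall fun _ => rfl)
      (.of_forall fun _ => rfl)]

/-- The Lax–Milgram theorem on a closed subspace. -/
theorem existsUnique_of_coercive_on {X : Type*} [NormedAddCommGroup X] [InnerProductSpace ℝ X]
    [CompleteSpace X] (S : Submodule ℝ X) (hS : IsClosed (S : Set X)) (B : X →L[ℝ] X →L[ℝ] ℝ)
    {c : ℝ} (hc : 0 < c) (hB : ∀ u ∈ S, c * ‖u‖ ^ 2 ≤ B u u) (ℓ : X →L[ℝ] ℝ) :
    ∃! u : X, u ∈ S ∧ ∀ w ∈ S, B u w = ℓ w := by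
  have : CompleteSpace S := hS.completeSpace_coe
  let BS : S →L[ℝ] S →L[ℝ] ℝ := B.bilinearComp S.subtypeL S.subtypeL
  have hco : IsCoercive BS := ⟨c, hc, fun u => by
    have := hB u u.2
    rw [mul_assoc, ← sq]
    exact this⟩
  let f : S := (InnerProductSpace.toDual ℝ S).symm (ℓ ∘L S.subtypeL)
  have hf : ∀ w : S, inner ℝ f w = ℓ w := fun w => by
    simp [f]
  refine ⟨(hco.continuousLinearEquivOfBilin.symm f : S), ⟨Subtype.prop _, fun w hw => ?_⟩, ?_⟩
  · have h1 := hco.continuousLinearEquivOfBilin_apply (hco.continuousLinearEquivOfBilin.symm f) ⟨w, hw⟩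
    rw [ContinuousLinearEquiv.apply_symm_apply, hf] at h1
    exact h1.symm
  · rintro u ⟨huS, hu⟩
    have h2 : f = hco.continuousLinearEquivOfBilin ⟨u, huS⟩ :=
      hco.unique_continuousLinearEquivOfBilin fun w => by
        rw [hf]; exact (hu w w.2).symm
    rw [h2, ContinuousLinearEquiv.symm_apply_apply]

theorem existsUnique_H1_of_coercive_on (S : Submodule ℝ (H1 Ω))
    (hS : IsClosed (S.map toAmbient : Set (Ambient Ω))) (A : E d → E d)
    (hA : MemLp A ⊤ ((volume : Measure (E d)).restrict Ω)) (κ β : ℝ) {c : ℝ} (hc : 0 < c)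
    (hco : ∀ u ∈ S, c * ‖toAmbient u‖ ^ 2 ≤ aForm A κ β u u) (ℓ : Ambient Ω →L[ℝ] ℝ) :
    ∃! u : H1 Ω, u ∈ S ∧ ∀ w ∈ S, aForm A κ β u w = ℓ (toAmbient w) := by
  obtain ⟨x, ⟨hxS, hx⟩, huniq⟩ := existsUnique_of_coercive_on _ hS (formOp A hA κ β) hc
    (by rintro _ ⟨u, hu, rfl⟩; rw [← aForm_eq_formOp]; exact hco u hu) ℓ
  obtain ⟨u, hu, rfl⟩ := hxS
  refine ⟨u, ⟨hu, fun w hw => ?_⟩, ?_⟩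
  · rw [aForm_eq_formOp A hA]
    exact hx _ ⟨w, hw, rfl⟩
  · rintro u' ⟨hu', h'⟩
    refine toAmbient_injective (huniq _ ⟨⟨u', hu', rfl⟩, ?_⟩)
    rintro _ ⟨w, hw, rfl⟩
    rw [← aForm_eq_formOp]
    exact h' w hw

/-! ### Norms and bounds for the forms -/

theorem l2Inner_coe (a b : L2 Ω) : l2Inner Ω a b = inner ℝ a b :=
  l2Inner_eq_inner (.of_forall fun _ => rfl) (.of_forall fun _ => rfl)

theorem normκ_nonneg (κ : ℝ) (v : H1 Ω) : 0 ≤ normκ κ v := Real.sqrt_nonneg _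

theorem normκ_sq (κ : ℝ) (v : H1 Ω) :
    normκ κ v ^ 2 = ‖toL2 v‖ ^ 2 + 1 / κ ^ 2 * ‖(toAmbient v).snd‖ ^ 2 := by
  rw [normκ, Real.sq_sqrt (by positivity), norm_toAmbient_snd_sq]

theorem norm_toL2_le_normκ (κ : ℝ) (v : H1 Ω) : ‖toL2 v‖ ≤ normκ κ v := by
  refine le_of_sq_le_sq ?_ (normκ_nonneg κ v)
  rw [normκ_sq]
  have : 0 ≤ 1 / κ ^ 2 * ‖(toAmbient v).snd‖ ^ 2 := by positivity
  linarith

theorem norm_snd_le_normκ {κ : ℝ} (hκ : 0 < κ) (v : H1 Ω) :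
    ‖(toAmbient v).snd‖ ≤ κ * normκ κ v := by
  refine le_of_sq_le_sq ?_ (mul_nonneg hκ.le (normκ_nonneg κ v))
  rw [mul_pow, normκ_sq, mul_add]
  have : κ ^ 2 * (1 / κ ^ 2 * ‖(toAmbient v).snd‖ ^ 2) = ‖(toAmbient v).snd‖ ^ 2 := by
    field_simp
  rw [this]
  have : 0 ≤ κ ^ 2 * ‖toL2 v‖ ^ 2 := by positivity
  linarith

theorem min_mul_norm_toAmbient_sq_le (κ : ℝ) (v : H1 Ω) :
    min 1 (1 / κ ^ 2) * ‖toAmbient v‖ ^ 2 ≤ normκ κ v ^ 2 := by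
  rw [normκ_sq, norm_toAmbient_sq, mul_add]
  gcongr
  · exact mul_le_of_le_one_left (by positivity) (min_le_left _ _)
  · exact min_le_right _ _

theorem eq_zero_of_normκ_nonpos {κ : ℝ} (hκ : 0 < κ) {v : H1 Ω} (h : normκ κ v ^ 2 ≤ 0) :
    v = 0 := by
  have h1 := (min_mul_norm_toAmbient_sq_le κ v).trans h
  have h2 : 0 < min 1 (1 / κ ^ 2) := lt_min one_pos (by positivity)
  have h3 : ‖toAmbient v‖ ^ 2 ≤ 0 := by
    by_contra! hcon
    exact absurd (mul_pos h2 hcon) (not_lt.2 h1)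
  have h4 : toAmbient v = 0 := by
    rw [← norm_eq_zero]
    exact pow_eq_zero_iff two_ne_zero |>.1 (le_antisymm h3 (sq_nonneg _))
  exact toAmbient_injective (by rw [h4, map_zero])

section Form

variable {A : E d → E d} (hA : MemLp A ⊤ ((volume : Measure (E d)).restrict Ω))
include hA

theorem aForm_sub_left (κ β : ℝ) (u v w : H1 Ω) :
    aForm A κ β (u - v) w = aForm A κ β u w - aForm A κ β v w := by
  simp only [aForm_eq_formOp A hA, map_sub, sub_apply]

theorem aForm_sub_right (κ β : ℝ) (u v w : H1 Ω) :
    aForm A κ β u (v - w) = aForm A κ β u v - aForm A κ β u w := by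
  simp only [aForm_eq_formOp A hA, map_sub]

theorem aForm_sum_left {ι : Type*} (κ β : ℝ) (s : Finset ι) (u : ι → H1 Ω) (w : H1 Ω) :
    aForm A κ β (∑ i ∈ s, u i) w = ∑ i ∈ s, aForm A κ β (u i) w := by
  simp only [aForm_eq_formOp A hA, map_sum, sum_apply]

theorem aForm_comm (κ β : ℝ) (u v : H1 Ω) : aForm A κ β u v = aForm A κ β v u := by
  rw [aForm_eq_formOp A hA, aForm_eq_formOp A hA, formOp_apply, formOp_apply,
    real_inner_comm, real_inner_comm (toAmbient v).fst]

theorem aForm_change_shift (κ β β' : ℝ) (u v : H1 Ω) :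
    aForm A κ β' u v = aForm A κ β u v + (β' - β) * inner ℝ (toL2 u) (toL2 v) := by
  simp only [aForm_eq_formOp A hA, formOp_apply, toAmbient_fst]
  ring

theorem norm_magGradOp_le {κ : ℝ} (hκ : 0 < κ) (v : H1 Ω) :
    ‖magGradOp A hA κ (toAmbient v)‖ ≤ (1 + supNorm Ω A) * normκ κ v := by
  have h1 : ‖(Complex.I / (κ : ℂ)) • (toAmbient v).snd‖ ≤ normκ κ v := by
    rw [norm_smul, norm_div, Complex.norm_I, Complex.norm_real, Real.norm_of_nonneg hκ.le,
      one_div, inv_mul_le_iff₀ hκ]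
    exact norm_snd_le_normκ hκ v
  have h2 : ‖mulField A hA (toL2 v)‖ ≤ supNorm Ω A * normκ κ v :=
    (norm_mulField_le hA _).trans
      (mul_le_mul_of_nonneg_left (norm_toL2_le_normκ κ v) (supNorm_nonneg A))
  rw [magGradOp_apply, toAmbient_fst]
  linarith [norm_add_le ((Complex.I / (κ : ℂ)) • (toAmbient v).snd) (mulField A hA (toL2 v))]

theorem aForm_le {κ β : ℝ} (hκ : 0 < κ) (hβ : 0 ≤ β) (v w : H1 Ω) :
    aForm A κ β v w ≤ ((1 + supNorm Ω A) ^ 2 + β) * (normκ κ v * normκ κ w) := by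
  rw [aForm_eq_formOp A hA, formOp_apply]
  have h1 : inner ℝ (magGradOp A hA κ (toAmbient v)) (magGradOp A hA κ (toAmbient w))
      ≤ ((1 + supNorm Ω A) * normκ κ v) * ((1 + supNorm Ω A) * normκ κ w) :=
    (real_inner_le_norm _ _).trans (mul_le_mul (norm_magGradOp_le hA hκ v)
      (norm_magGradOp_le hA hκ w) (norm_nonneg _)
      (mul_nonneg (by linarith [supNorm_nonneg (Ω := Ω) A]) (normκ_nonneg κ v)))
  have h2 : inner ℝ (toL2 v) (toL2 w) ≤ normκ κ v * normκ κ w :=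
    (real_inner_le_norm _ _).trans (mul_le_mul (norm_toL2_le_normκ κ v)
      (norm_toL2_le_normκ κ w) (norm_nonneg _) (normκ_nonneg κ v))
  have h3 := mul_le_mul_of_nonneg_left h2 hβ
  simp only [toAmbient_fst]
  nlinarith

/-- A Gårding inequality, from `|x + y|² ≥ |x|²/2 - |y|²`. -/
theorem le_aForm_self {κ : ℝ} (hκ : 0 < κ) (β : ℝ) (v : H1 Ω) :
    1 / 2 * (1 / κ ^ 2 * ‖(toAmbient v).snd‖ ^ 2) + (β - supNorm Ω A ^ 2) * ‖toL2 v‖ ^ 2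
      ≤ aForm A κ β v v := by
  rw [aForm_eq_formOp A hA, formOp_apply, real_inner_self_eq_norm_sq, real_inner_self_eq_norm_sq,
    toAmbient_fst]
  set y := (Complex.I / (κ : ℂ)) • (toAmbient v).snd with hy
  have hyn : ‖y‖ ^ 2 = 1 / κ ^ 2 * ‖(toAmbient v).snd‖ ^ 2 := by
    rw [hy, norm_smul, norm_div, Complex.norm_I, Complex.norm_real, Real.norm_of_nonneg hκ.le,
      mul_pow, div_pow, one_pow]
  have hG : magGradOp A hA κ (toAmbient v) = y + mulField A hA (toL2 v) := rfl
  have h1 : ‖y‖ ≤ ‖magGradOp A hA κ (toAmbient v)‖ + ‖mulField A hA (toL2 v)‖ := by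
    have := norm_sub_le (magGradOp A hA κ (toAmbient v)) (mulField A hA (toL2 v))
    rwa [hG, add_sub_cancel_right, ← hG] at this
  have h2 : ‖mulField A hA (toL2 v)‖ ^ 2 ≤ supNorm Ω A ^ 2 * ‖toL2 v‖ ^ 2 := by
    rw [← mul_pow]
    gcongr
    exact norm_mulField_le hA _
  have h3 : ‖y‖ ^ 2 ≤ 2 * ‖magGradOp A hA κ (toAmbient v)‖ ^ 2
      + 2 * ‖mulField A hA (toL2 v)‖ ^ 2 := by
    nlinarith [norm_nonneg y, sq_nonneg (‖magGradOp A hA κ (toAmbient v)‖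
      - ‖mulField A hA (toL2 v)‖), norm_nonneg (magGradOp A hA κ (toAmbient v)),
      norm_nonneg (mulField A hA (toL2 v))]
  rw [← hyn]
  linarith

theorem coercive_betaTilde {κ : ℝ} (hκ : 0 < κ) (v : H1 Ω) :
    1 / 2 * normκ κ v ^ 2 ≤ aForm A κ (betaTilde Ω A) v v := by
  have h := le_aForm_self hA hκ (betaTilde Ω A) v
  rw [betaTilde] at h ⊢
  rw [normκ_sq]
  linarith

end Form

theorem betaTilde_pos (A : E d → E d) : 0 < betaTilde Ω A := by
  unfold betaTilde; positivity

/-! ### Well-posedness and the LOD space as an orthogonal complement -/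

section Mesh

variable (T : Mesh Ω)

theorem Mesh.isL2Proj_iff {f : L2 Ω} {p : H1 Ω} : T.IsL2Proj f p ↔
    p ∈ T.Vh ∧ ∀ v ∈ T.Vh, inner ℝ (f - toL2 p) (toL2 v) = 0 := by
  simp only [Mesh.IsL2Proj, l2Inner_coe, inner_sub_left, sub_eq_zero]
  simp only [eq_comm]

theorem Mesh.mem_W_iff {w : H1 Ω} : w ∈ T.W ↔ ∀ v ∈ T.Vh, inner ℝ (toL2 w) (toL2 v) = 0 := by
  have h0 : toL2 (0 : H1 Ω) = 0 := rfl
  show T.IsL2Proj (toL2 w) 0 ↔ _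
  rw [T.isL2Proj_iff, h0, sub_zero]
  exact and_iff_right T.VhSubmodule.zero_mem

theorem Mesh.existsUnique_isL2Proj (ho : IsOpen Ω) (f : L2 Ω) : ∃! p : H1 Ω, T.IsL2Proj f p := by
  have := T.finiteDimensional_map_toL2 ho
  set S := T.VhSubmodule.map toL2Lin with hS
  obtain ⟨p, hp, hpf⟩ := (S.starProjection_apply_mem f)
  refine ⟨p, T.isL2Proj_iff.2 ⟨hp, fun v hv => ?_⟩, fun p' hp' => ?_⟩
  · rw [← toL2Lin_apply p, hpf]
    exact Submodule.starProjection_inner_eq_zero f _ ⟨v, hv, rfl⟩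
  · refine toL2_injective ho ?_
    rw [hpf]
    refine (Submodule.eq_starProjection_of_mem_of_inner_eq_zero (K := S)
      (show toL2Lin p' ∈ S from ⟨p', hp'.1, rfl⟩) ?_).symm
    rintro _ ⟨v, hv, rfl⟩
    exact (T.isL2Proj_iff.1 hp').2 v hv

theorem Mesh.IsL2Proj.norm_sub_le {T : Mesh Ω} {f : L2 Ω} {p v : H1 Ω} (hp : T.IsL2Proj f p)
    (hv : v ∈ T.Vh) : ‖f - toL2 p‖ ≤ ‖f - toL2 v‖ := by
  obtain ⟨hpV, hp⟩ := T.isL2Proj_iff.1 hp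
  have h1 : inner ℝ (f - toL2 p) (toL2 (p - v)) = 0 := hp _ (T.VhSubmodule.sub_mem hpV hv)
  have h2 : f - toL2 v = (f - toL2 p) + toL2 (p - v) := by
    have : toL2 (p - v) = toL2 p - toL2 v := rfl
    rw [this]; abel
  refine le_of_sq_le_sq ?_ (norm_nonneg _)
  rw [h2, norm_add_sq_real, h1]
  nlinarith [sq_nonneg ‖toL2 (p - v)‖]

/-- The detail space `W` as a real vector space. -/
def Mesh.WSubmodule : Submodule ℝ (H1 Ω) where
  carrier := T.W
  add_mem' := by
    intro u v hu hv
    rw [T.mem_W_iff] at *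
    intro w hw
    have : toL2 (u + v) = toL2 u + toL2 v := rfl
    rw [this, inner_add_left, hu w hw, hv w hw, add_zero]
  zero_mem' := by
    rw [T.mem_W_iff]
    intro w _
    exact inner_zero_left _
  smul_mem' := by
    intro c u hu
    rw [T.mem_W_iff] at *
    intro w hw
    have : toL2 (c • u) = c • toL2 u := rfl
    rw [this, inner_smul_left, hu w hw, mul_zero]

theorem Mesh.isClosed_map_W : IsClosed (T.WSubmodule.map toAmbient : Set (Ambient Ω)) := by
  have : (T.WSubmodule.map toAmbient : Set (Ambient Ω)) =
      (LinearMap.range (toAmbient : H1 Ω →ₗ[ℝ] Ambient Ω) : Set (Ambient Ω)) ∩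
        ⋂ v ∈ T.Vh, {x : Ambient Ω | inner ℝ x.fst (toL2 v) = 0} := by
    ext x
    simp only [mem_inter_iff, mem_iInter]
    constructor
    · rintro ⟨w, hw, rfl⟩
      exact ⟨⟨w, rfl⟩, T.mem_W_iff.1 hw⟩
    · rintro ⟨⟨w, rfl⟩, h⟩
      exact ⟨w, T.mem_W_iff.2 h, rfl⟩
  rw [this]
  refine isClosed_range_toAmbient.inter (isClosed_biInter fun v _ => isClosed_eq ?_ ?_) <;> fun_prop

/-- The `a_β`-orthogonal complement of `W` in `H¹`. -/
def Mesh.orthW {A : E d → E d} (hA : MemLp A ⊤ ((volume : Measure (E d)).restrict Ω)) (κ β : ℝ) :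
    Submodule ℝ (H1 Ω) :=
  ⨅ w ∈ T.W, LinearMap.ker
    (((formOp A hA κ β).flip (toAmbient w)).toLinearMap ∘ₗ (toAmbient : H1 Ω →ₗ[ℝ] Ambient Ω))

theorem Mesh.mem_orthW {A : E d → E d} (hA : MemLp A ⊤ ((volume : Measure (E d)).restrict Ω))
    {κ β : ℝ} {u : H1 Ω} : u ∈ T.orthW hA κ β ↔ ∀ w ∈ T.W, aForm A κ β u w = 0 := by
  simp [Mesh.orthW, Submodule.mem_iInf, aForm_eq_formOp A hA]

theorem Mesh.isClosed_map_orthW {A : E d → E d}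
    (hA : MemLp A ⊤ ((volume : Measure (E d)).restrict Ω)) (κ β : ℝ) :
    IsClosed ((T.orthW hA κ β).map toAmbient : Set (Ambient Ω)) := by
  have : ((T.orthW hA κ β).map toAmbient : Set (Ambient Ω)) =
      (LinearMap.range (toAmbient : H1 Ω →ₗ[ℝ] Ambient Ω) : Set (Ambient Ω)) ∩
        ⋂ w ∈ T.W, {x : Ambient Ω | (formOp A hA κ β).flip (toAmbient w) x = 0} := by
    ext x
    simp only [mem_inter_iff, mem_iInter]
    constructor
    · rintro ⟨u, hu, rfl⟩
      refine ⟨⟨u, rfl⟩, fun w hw => ?_⟩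
      have := (T.mem_orthW hA).1 hu w hw
      rwa [aForm_eq_formOp A hA] at this
    · rintro ⟨⟨u, rfl⟩, h⟩
      refine ⟨u, (T.mem_orthW hA).2 fun w hw => ?_, rfl⟩
      rw [aForm_eq_formOp A hA]
      exact h w hw
  rw [this]
  refine isClosed_range_toAmbient.inter (isClosed_biInter fun v _ => isClosed_eq ?_ ?_) <;> fun_prop

section Coercive

variable {A : E d → E d} (hA : MemLp A ⊤ ((volume : Measure (E d)).restrict Ω)) {κ β : ℝ}
  (hκ : 0 < κ) (hco : ∀ w ∈ T.W, 1 / 4 * normκ κ w ^ 2 ≤ aForm A κ β w w)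
include hA hκ hco

theorem Mesh.existsUnique_W (ℓ : Ambient Ω →L[ℝ] ℝ) :
    ∃! c : H1 Ω, c ∈ T.W ∧ ∀ w ∈ T.W, aForm A κ β c w = ℓ (toAmbient w) := by
  have hc : 0 < 1 / 4 * min 1 (1 / κ ^ 2) :=
    mul_pos (by norm_num) (lt_min one_pos (by positivity))
  refine existsUnique_H1_of_coercive_on T.WSubmodule T.isClosed_map_W A hA κ β hc ?_ ℓ
  intro u hu
  refine le_trans ?_ (hco u hu)
  rw [mul_assoc]
  gcongr
  exact min_mul_norm_toAmbient_sq_le κ u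

theorem Mesh.existsUnique_isElementCorrector (v : H1 Ω) (K : Finset (E d)) :
    ∃! c : H1 Ω, T.IsElementCorrector A κ β K v c := by
  obtain ⟨ℓ, hℓ⟩ := exists_aFormOn_eq A hA κ β
    (isCompact_convexHull_finset K).isClosed.measurableSet v
  simp only [Mesh.IsElementCorrector, hℓ]
  exact T.existsUnique_W hA hκ hco ℓ

/-- The component `w₀` of `z` in `W`, for the `a_β`-orthogonal splitting of `H¹` into `W` and its
complement. -/
theorem Mesh.exists_W_component (z : H1 Ω) :
    ∃ w₀ ∈ T.W, ∀ w ∈ T.W, aForm A κ β w₀ w = aForm A κ β z w := by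
  obtain ⟨c, ⟨hc, h⟩, -⟩ := T.existsUnique_W hA hκ hco (formOp A hA κ β (toAmbient z))
  exact ⟨c, hc, fun w hw => by rw [h w hw, aForm_eq_formOp A hA]⟩

/-- The LOD space is the `a_β`-orthogonal complement of `W`. For `u` in the complement, the LOD function
of `π_h u` differs from `u` by an element of `W` that is orthogonal to `W`, hence zero. -/
theorem Mesh.Vlod_eq_orthW (ho : IsOpen Ω) : T.Vlod A κ β = T.orthW hA κ β := by
  have key : ∀ v ∈ T.Vh, ∀ c : Finset (E d) → H1 Ω,
      (∀ K ∈ T.elems, T.IsElementCorrector A κ β K v (c K)) →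
      v - ∑ K ∈ T.elems, c K ∈ T.orthW hA κ β := by
    intro v _ c hc
    rw [T.mem_orthW hA]
    intro w hw
    rw [aForm_sub_left hA, aForm_sum_left hA, Finset.sum_congr rfl fun K hK => (hc K hK).2 w hw,
      T.sum_aFormOn ho A hA, sub_self]
  ext u
  constructor
  · rintro ⟨v, hv, c, hc, rfl⟩
    exact key v hv c hc
  · intro hu
    obtain ⟨p, hp, -⟩ := T.existsUnique_isL2Proj ho (toL2 u)
    obtain ⟨hpV, hpo⟩ := T.isL2Proj_iff.1 hp
    choose c hc using fun K => (T.existsUnique_isElementCorrector hA hκ hco p K).exists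
    refine ⟨p, hpV, c, fun K _ => hc K, ?_⟩
    have h1 : u - (p - ∑ K ∈ T.elems, c K) ∈ T.orthW hA κ β :=
      Submodule.sub_mem _ hu (key p hpV c fun K _ => hc K)
    have hup : u - p ∈ T.WSubmodule := T.mem_W_iff.2 hpo
    have h2 : u - (p - ∑ K ∈ T.elems, c K) ∈ T.WSubmodule := by
      rw [← sub_add]
      exact Submodule.add_mem _ hup (Submodule.sum_mem _ fun K _ => (hc K).1)
    have h3 := hco _ h2
    rw [(T.mem_orthW hA).1 h1 _ h2] at h3
    exact sub_eq_zero.1 (eq_zero_of_normκ_nonpos hκ (by linarith))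

theorem Mesh.existsUnique_isRitzProj (ho : IsOpen Ω) (v : H1 Ω) :
    ∃! r : H1 Ω, T.IsRitzProj A κ β v r := by
  have hc : 0 < 1 / 2 * min 1 (1 / κ ^ 2) :=
    mul_pos (by norm_num) (lt_min one_pos (by positivity))
  have h := existsUnique_H1_of_coercive_on (T.orthW hA κ β) (T.isClosed_map_orthW hA κ β) A hA κ
    (betaTilde Ω A) hc (fun u _ => by
      refine le_trans ?_ (coercive_betaTilde hA hκ u)
      rw [mul_assoc]
      gcongr
      exact min_mul_norm_toAmbient_sq_le κ u) (formOp A hA κ (betaTilde Ω A) (toAmbient v))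
  simp only [← aForm_eq_formOp] at h
  simpa only [Mesh.IsRitzProj, T.Vlod_eq_orthW hA hκ hco ho, SetLike.mem_coe] using h

/-- Céa's lemma for the Ritz projection. -/
theorem Mesh.normκ_sub_ritz_le (ho : IsOpen Ω) {z r y : H1 Ω} (hr : T.IsRitzProj A κ β z r)
    (hy : y ∈ T.orthW hA κ β) :
    normκ κ (z - r)
      ≤ 2 * ((1 + supNorm Ω A) ^ 2 + betaTilde Ω A) * normκ κ (z - y) := by
  rw [Mesh.IsRitzProj, T.Vlod_eq_orthW hA hκ hco ho] at hr
  obtain ⟨hrV, hr⟩ := hr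
  have h1 := coercive_betaTilde hA hκ (z - r)
  have h2 : aForm A κ (betaTilde Ω A) (z - r) (y - r) = 0 := by
    rw [aForm_sub_left hA, hr _ (Submodule.sub_mem _ hy hrV), sub_self]
  have h3 : aForm A κ (betaTilde Ω A) (z - r) (z - r)
      = aForm A κ (betaTilde Ω A) (z - r) (z - y) := by
    rw [← sub_zero (aForm A κ (betaTilde Ω A) (z - r) (z - r)), ← h2, ← aForm_sub_right hA,
      sub_sub_sub_cancel_right]
  have h4 := aForm_le hA hκ (betaTilde_pos (Ω := Ω) A).le (z - r) (z - y)
  rw [h3] at h1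
  rcases (normκ_nonneg κ (z - r)).eq_or_lt with h0 | h0
  · rw [← h0]
    exact mul_nonneg (mul_nonneg zero_le_two
      (add_nonneg (sq_nonneg _) (betaTilde_pos A).le)) (normκ_nonneg _ _)
  · refine le_of_mul_le_mul_left ?_ h0
    nlinarith

end Coercive

end Mesh

/-! ### The error estimates -/

/-- `C` is an approximation constant of `Ω` if `‖u - π_h u‖ ≤ C h ‖∇u‖` for all meshes of `Ω` and all
`u ∈ H¹(Ω)`. -/
def IsApproxConstant (Ω : Set (E d)) (C : ℝ) : Prop :=
  0 < C ∧ ∀ (T : Mesh Ω) (u p : H1 Ω), T.IsL2Proj (toL2 u) p →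
    ‖toL2 u - toL2 p‖ ≤ C * T.size * ‖(toAmbient u).snd‖

theorem exists_isApproxConstant (hd : 0 < d) (ho : IsOpen Ω) (hc : Convex ℝ Ω)
    (hb : Bornology.IsBounded Ω) (hne : Ω.Nonempty) : ∃ C, IsApproxConstant Ω C := by
  obtain ⟨C, hC, h⟩ := exists_quasiInterpolant hd ho hc hb hne
  refine ⟨C, hC, fun T u p hp => ?_⟩
  obtain ⟨v, hv, hv'⟩ := h T u
  have hs := (T.size_pos hd hne).le
  refine (hp.norm_sub_le hv).trans (le_of_sq_le_sq ?_ (by positivity))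
  rw [mul_pow, norm_toAmbient_snd_sq]
  exact hv'

theorem IsApproxConstant.norm_le_of_mem_W {C : ℝ} (hC : IsApproxConstant Ω C) {T : Mesh Ω}
    {w : H1 Ω} (hw : w ∈ T.W) : ‖toL2 w‖ ≤ C * T.size * ‖(toAmbient w).snd‖ := by
  have h0 : toL2 (0 : H1 Ω) = 0 := rfl
  simpa [h0] using hC.2 T w 0 hw

theorem IsApproxConstant.exists_isResolutionConstant {C : ℝ} (hC : IsApproxConstant Ω C)
    (hd : 0 < d) (hne : Ω.Nonempty) {A : E d → E d}
    (hA : MemLp A ⊤ ((volume : Measure (E d)).restrict Ω)) (σ q : ℝ) :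
    ∃ Cres, IsResolutionConstant Ω A σ q Cres := by
  have ha := supNorm_nonneg (Ω := Ω) A
  set a := supNorm Ω A with ha'
  -- With this choice `(1 + 2a)² ‖w‖² ≤ κ⁻² ‖∇w‖²`, and `1/4 + a² ≤ (1 + 2a)² / 4`.
  refine ⟨1 / (C * (1 + 2 * a)), by have := hC.1; positivity, ?_⟩
  intro κ hκ T _ _ hh β _ w hw
  have h1 := hC.norm_le_of_mem_W hw
  have h2 := le_aForm_self hA hκ β w
  have hCpos := hC.1
  have hs := T.size_pos hd hne
  set g := ‖(toAmbient w).snd‖ with hg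
  have hg0 : 0 ≤ g := norm_nonneg _
  have h3 : (1 + 2 * a) * ‖toL2 w‖ ≤ 1 / κ * g := by
    have e1 : C * T.size ≤ 1 / (1 + 2 * a) * (1 / κ) := by
      calc C * T.size ≤ C * (1 / (C * (1 + 2 * a)) * κ⁻¹) := by gcongr
        _ = _ := by field_simp
    calc (1 + 2 * a) * ‖toL2 w‖ ≤ (1 + 2 * a) * (1 / (1 + 2 * a) * (1 / κ) * g) := by
          gcongr
          exact h1.trans (by gcongr)
      _ = 1 / κ * g := by field_simp
  have h4 : (1 + 2 * a) ^ 2 * ‖toL2 w‖ ^ 2 ≤ 1 / κ ^ 2 * g ^ 2 := by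
    have := pow_le_pow_left₀ (by positivity) h3 2
    rwa [mul_pow, mul_pow, div_pow, one_pow] at this
  rw [normκ_sq]
  nlinarith [mul_nonneg ha (sq_nonneg ‖toL2 w‖)]

section Estimates

variable {C : ℝ} (hC : IsApproxConstant Ω C) (T : Mesh Ω) (ho : IsOpen Ω) {A : E d → E d}
  (hA : MemLp A ⊤ ((volume : Measure (E d)).restrict Ω)) {κ β : ℝ} (hκ : 0 < κ) (hβ : 0 ≤ β)
  (hh : 0 < T.size)
include hC hκ hh

theorem norm_sub_proj_le {u p : H1 Ω} (hp : T.IsL2Proj (toL2 u) p) :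
    ‖toL2 u - toL2 p‖ ≤ C * T.size * κ * normκ κ u := by
  rw [mul_assoc]
  have := hC.1
  exact (hC.2 T u p hp).trans (by gcongr; exact norm_snd_le_normκ hκ u)

theorem norm_toL2_le_of_mem_W {w : H1 Ω} (hw : w ∈ T.W) :
    ‖toL2 w‖ ≤ C * T.size * κ * normκ κ w := by
  rw [mul_assoc]
  have := hC.1
  exact (hC.norm_le_of_mem_W hw).trans (by gcongr; exact norm_snd_le_normκ hκ w)

include ho hA hβ

/-- The energy estimate. For a solution `z` with right-hand side `f`, the component `w₀` of `z` in `W`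
sees only `f - π_h f`. -/
theorem normκ_sub_ritz_le_of_solution
    (hco : ∀ w ∈ T.W, 1 / 4 * normκ κ w ^ 2 + β * ‖toL2 w‖ ^ 2 ≤ aForm A κ β w w)
    {z : H1 Ω} {f : L2 Ω} (hz : ∀ w : H1 Ω, aForm A κ β z w = inner ℝ f (toL2 w)) {r p : H1 Ω}
    (hr : T.IsRitzProj A κ β z r) (hp : T.IsL2Proj f p) :
    normκ κ (z - r) ≤ 2 * ((1 + supNorm Ω A) ^ 2 + betaTilde Ω A) *
      (4 * C * T.size * κ * ‖f - toL2 p‖) := by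
  have hco' : ∀ w ∈ T.W, 1 / 4 * normκ κ w ^ 2 ≤ aForm A κ β w w := fun w hw =>
    le_trans (le_add_of_nonneg_right (by positivity)) (hco w hw)
  obtain ⟨w₀, hw₀, hw⟩ := T.exists_W_component hA hκ hco' z
  have hy : z - w₀ ∈ T.orthW hA κ β := by
    rw [T.mem_orthW hA]
    intro w hw'
    rw [aForm_sub_left hA, hw w hw', sub_self]
  have h1 := T.normκ_sub_ritz_le hA hκ hco' ho hr hy
  rw [sub_sub_cancel] at h1
  refine h1.trans ?_
  have hb := betaTilde_pos (Ω := Ω) A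
  gcongr
  have h2 : 1 / 4 * normκ κ w₀ ^ 2 ≤ ‖f - toL2 p‖ * ‖toL2 w₀‖ := by
    calc 1 / 4 * normκ κ w₀ ^ 2 ≤ aForm A κ β w₀ w₀ := hco' w₀ hw₀
      _ = inner ℝ (f - toL2 p) (toL2 w₀) := by
        rw [hw w₀ hw₀, hz, inner_sub_left, real_inner_comm _ (toL2 p),
          T.mem_W_iff.1 hw₀ p hp.1, sub_zero]
      _ ≤ _ := real_inner_le_norm _ _
  have h3 := norm_toL2_le_of_mem_W hC T hκ hh hw₀
  rcases (normκ_nonneg κ w₀).eq_or_lt with h0 | h0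
  · rw [← h0]
    have := hC.1
    positivity
  · refine le_of_mul_le_mul_left ?_ h0
    nlinarith [mul_le_mul_of_nonneg_left h3 (norm_nonneg (f - toL2 p))]

/-- The `L²` estimate, by an Aubin–Nitsche argument with the form `a_β̃`. -/
theorem norm_sub_ritz_le
    (hco : ∀ w ∈ T.W, 1 / 4 * normκ κ w ^ 2 + β * ‖toL2 w‖ ^ 2 ≤ aForm A κ β w w)
    {z r : H1 Ω} (hr : T.IsRitzProj A κ β z r) :
    ‖toL2 (z - r)‖ ≤ ((1 + supNorm Ω A) ^ 2 + betaTilde Ω A) * (4 * (1 + 2 * betaTilde Ω A)) *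
      (C * T.size * κ * Real.sqrt (1 + β) * normκ κ (z - r)) := by
  have hco' : ∀ w ∈ T.W, 1 / 4 * normκ κ w ^ 2 ≤ aForm A κ β w w := fun w hw =>
    le_trans (le_add_of_nonneg_right (by positivity)) (hco w hw)
  have hb := betaTilde_pos (Ω := Ω) A
  have hCpos := hC.1
  set bt := betaTilde Ω A with hbt
  set e := z - r with he
  -- The dual problem `a_β̃(φ, ·) = (e, ·)`.
  have hc : 0 < 1 / 2 * min 1 (1 / κ ^ 2) :=
    mul_pos (by norm_num) (lt_min one_pos (by positivity))
  obtain ⟨φ, ⟨-, hφ⟩, -⟩ := existsUnique_H1_of_coercive_on (⊤ : Submodule ℝ (H1 Ω))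
    (by rw [Submodule.map_top]; exact isClosed_range_toAmbient) A hA κ bt hc (fun u _ => by
      refine le_trans ?_ (coercive_betaTilde hA hκ u)
      rw [mul_assoc]
      gcongr
      exact min_mul_norm_toAmbient_sq_le κ u)
    (innerSL ℝ (toL2 e) ∘L WithLp.fstL 2 ℝ (L2 Ω) (GradSpace Ω))
  replace hφ : ∀ w : H1 Ω, aForm A κ bt φ w = inner ℝ (toL2 e) (toL2 w) := fun w => hφ w trivial
  have hφN : normκ κ φ ≤ 2 * ‖toL2 e‖ := by
    have h1 := coercive_betaTilde hA hκ φ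
    rw [← hbt, hφ] at h1
    have h2 := real_inner_le_norm (toL2 e) (toL2 φ)
    have h3 := mul_le_mul_of_nonneg_left (norm_toL2_le_normκ κ φ) (norm_nonneg (toL2 e))
    rcases (normκ_nonneg κ φ).eq_or_lt with h0 | h0
    · rw [← h0]; positivity
    · refine le_of_mul_le_mul_left ?_ h0
      nlinarith
  obtain ⟨w₀, hw₀, hw⟩ := T.exists_W_component hA hκ hco' φ
  have hy : φ - w₀ ∈ T.orthW hA κ β := by
    rw [T.mem_orthW hA]
    intro w hw'
    rw [aForm_sub_left hA, hw w hw', sub_self]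
  obtain ⟨p, hp, -⟩ := T.existsUnique_isL2Proj ho (toL2 φ)
  set H := C * T.size * κ with hH
  have hHpos : 0 < H := by positivity
  have hφp : ‖toL2 φ - toL2 p‖ ≤ H * (2 * ‖toL2 e‖) :=
    (norm_sub_proj_le hC T hκ hh hp).trans (by gcongr)
  have hn1 : ‖toL2 w₀‖ ≤ H * normκ κ w₀ := norm_toL2_le_of_mem_W hC T hκ hh hw₀
  have hn2 := norm_toL2_le_normκ κ w₀
  have hN0 := normκ_nonneg κ w₀
  have hmain : 1 / 4 * normκ κ w₀ ^ 2 + β * ‖toL2 w₀‖ ^ 2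
      ≤ ‖toL2 e‖ * ‖toL2 w₀‖ + (β + bt) * (H * (2 * ‖toL2 e‖) * ‖toL2 w₀‖) := by
    have h1 : inner ℝ (toL2 φ) (toL2 w₀) = inner ℝ (toL2 φ - toL2 p) (toL2 w₀) := by
      rw [inner_sub_left, real_inner_comm _ (toL2 p), T.mem_W_iff.1 hw₀ p hp.1, sub_zero]
    have h2 : |inner ℝ (toL2 φ) (toL2 w₀)| ≤ H * (2 * ‖toL2 e‖) * ‖toL2 w₀‖ := by
      rw [h1]
      exact (abs_real_inner_le_norm _ _).trans (by gcongr)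
    have h3 : |β - bt| ≤ β + bt := abs_le.2 ⟨by linarith, by linarith⟩
    calc 1 / 4 * normκ κ w₀ ^ 2 + β * ‖toL2 w₀‖ ^ 2 ≤ aForm A κ β w₀ w₀ := hco w₀ hw₀
      _ = inner ℝ (toL2 e) (toL2 w₀) + (β - bt) * inner ℝ (toL2 φ) (toL2 w₀) := by
        rw [hw w₀ hw₀, aForm_change_shift hA κ bt β, hφ]
      _ ≤ ‖toL2 e‖ * ‖toL2 w₀‖ + |β - bt| * |inner ℝ (toL2 φ) (toL2 w₀)| := by
        rw [← abs_mul]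
        exact add_le_add (real_inner_le_norm _ _) (le_abs_self _)
      _ ≤ _ := by gcongr
  have hN : normκ κ w₀ ≤ 4 * (1 + 2 * bt) * (H * Real.sqrt (1 + β) * ‖toL2 e‖) := by
    refine le_of_sq_le_sq ?_ (by positivity)
    have hs : Real.sqrt (1 + β) ^ 2 = 1 + β := Real.sq_sqrt (by positivity)
    have e0 := norm_nonneg (toL2 e)
    -- The `β`-part is absorbed by the coercivity of `a_β` on `W`, which is why only `√β` remains.
    have y1 : β * (H * (2 * ‖toL2 e‖) * ‖toL2 w₀‖) ≤ β * ‖toL2 w₀‖ ^ 2 + β * (H * ‖toL2 e‖) ^ 2 := by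
      have := mul_le_mul_of_nonneg_left
        (two_mul_le_add_sq (‖toL2 w₀‖) (H * ‖toL2 e‖)) hβ
      linarith
    have y2 : ‖toL2 e‖ * ‖toL2 w₀‖ ≤ H * ‖toL2 e‖ * normκ κ w₀ := by
      have := mul_le_mul_of_nonneg_left hn1 e0
      linarith
    have y3 : bt * (H * (2 * ‖toL2 e‖) * ‖toL2 w₀‖) ≤ 2 * bt * (H * ‖toL2 e‖ * normκ κ w₀) := by
      have := mul_le_mul_of_nonneg_left hn2 (show 0 ≤ 2 * bt * (H * ‖toL2 e‖) by positivity)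
      linarith
    set X := H * ‖toL2 e‖ with hX
    have hX0 : 0 ≤ X := by positivity
    have y4 : 1 / 4 * normκ κ w₀ ^ 2 ≤ (1 + 2 * bt) * X * normκ κ w₀ + β * X ^ 2 := by linarith
    have y5 : (1 + 2 * bt) * X * normκ κ w₀ ≤ 1 / 8 * normκ κ w₀ ^ 2
        + 2 * ((1 + 2 * bt) * X) ^ 2 := by
      nlinarith [sq_nonneg (normκ κ w₀ - 4 * ((1 + 2 * bt) * X))]
    have y6 : β * X ^ 2 ≤ β * ((1 + 2 * bt) * X) ^ 2 := by
      gcongr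
      nlinarith
    have y7 : (4 * (1 + 2 * bt) * (H * Real.sqrt (1 + β) * ‖toL2 e‖)) ^ 2
        = 16 * (1 + β) * ((1 + 2 * bt) * X) ^ 2 := by
      rw [hX, mul_pow, mul_pow (H * Real.sqrt (1 + β)), mul_pow H, hs]; ring
    rw [y7]
    have y8 : 0 ≤ β * ((1 + 2 * bt) * X) ^ 2 := by positivity
    linarith
  have hE : ‖toL2 e‖ ^ 2 ≤ ((1 + supNorm Ω A) ^ 2 + bt) * (normκ κ w₀ * normκ κ e) := by
    have h1 : aForm A κ bt (φ - w₀) e = 0 := by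
      rw [Mesh.IsRitzProj, T.Vlod_eq_orthW hA hκ hco' ho] at hr
      rw [aForm_comm hA, he, aForm_sub_left hA, hr.2 _ hy, sub_self]
    have h2 : ‖toL2 e‖ ^ 2 = aForm A κ bt w₀ e := by
      rw [← real_inner_self_eq_norm_sq, ← hφ, ← sub_eq_zero, ← aForm_sub_left hA, h1]
    rw [h2]
    exact aForm_le hA hκ hb.le _ _
  rcases (norm_nonneg (toL2 e)).eq_or_lt with h0 | h0
  · rw [← h0]
    have := normκ_nonneg κ e
    positivity
  · refine le_of_mul_le_mul_left ?_ h0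
    calc ‖toL2 e‖ * ‖toL2 e‖ = ‖toL2 e‖ ^ 2 := (sq _).symm
      _ ≤ _ := hE
      _ ≤ ((1 + supNorm Ω A) ^ 2 + bt) * ((4 * (1 + 2 * bt) *
          (H * Real.sqrt (1 + β) * ‖toL2 e‖)) * normκ κ e) := by
        have := normκ_nonneg κ e
        gcongr
      _ = _ := by ring

end Estimates

end LOD

end

theorem lemma4p4 {d : ℕ} (hd : d = 2 ∨ d = 3) (Ω : Set (LOD.E d)) (hΩ : LOD.IsConvexPolytope Ω)
    (A : LOD.E d → LOD.E d) (hA : LOD.IsMagneticPotential Ω A) (σ q : ℝ) :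
    -- resolution constants exist
    (∃ Cres : ℝ, LOD.IsResolutionConstant Ω A σ q Cres) ∧
    -- the constant `C` depends only on `Ω`, `A` and the mesh regularity
    ∃ C : ℝ, 0 < C ∧ ∀ Cres : ℝ, LOD.IsResolutionConstant Ω A σ q Cres →
      ∀ κ : ℝ, 0 < κ → ∀ T : LOD.Mesh Ω, T.ShapeRegular σ → T.QuasiUniform q →
        T.size ≤ Cres * κ⁻¹ → ∀ β : ℝ, 0 ≤ β →
        -- the L² projection, the element correctors and the Ritz projection are well defined
        (∀ f : LOD.L2 Ω, ∃! p : LOD.H1 Ω, T.IsL2Proj f p) ∧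
        (∀ v ∈ T.Vh, ∀ K ∈ T.elems, ∃! c : LOD.H1 Ω, T.IsElementCorrector A κ β K v c) ∧
        (∀ v : LOD.H1 Ω, ∃! r : LOD.H1 Ω, T.IsRitzProj A κ β v r) ∧
        -- the two estimates
        ∀ (z : LOD.H1 Ω) (f : LOD.L2 Ω),
          (∀ w : LOD.H1 Ω, LOD.aForm A κ β z w = LOD.l2Inner Ω f (LOD.toL2 w)) →
          ∀ r p : LOD.H1 Ω, T.IsRitzProj A κ β z r → T.IsL2Proj f p →
            LOD.normκ κ (z - r) ≤ C * (T.size * κ * ‖f - LOD.toL2 p‖) ∧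
            ‖LOD.toL2 (z - r)‖ ≤ C * (T.size * κ * Real.sqrt (1 + β) * LOD.normκ κ (z - r)) := by
  obtain ⟨hne, s, hs⟩ := hΩ
  have hd0 : 0 < d := by omega
  have ho : IsOpen Ω := hs ▸ isOpen_interior
  have hc : Convex ℝ Ω := hs ▸ (convex_convexHull ℝ _).interior
  have hb : Bornology.IsBounded Ω := by
    rw [hs]
    exact (LOD.isCompact_convexHull_finset s).isBounded.subset interior_subset
  have hAm := hA.memLp
  obtain ⟨C, hC⟩ := LOD.exists_isApproxConstant hd0 ho hc hb hne
  refine ⟨hC.exists_isResolutionConstant hd0 hne hAm σ q, ?_⟩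
  have hCpos := hC.1
  have hbt := LOD.betaTilde_pos (Ω := Ω) A
  set M := (1 + LOD.supNorm Ω A) ^ 2 + LOD.betaTilde Ω A with hM
  have hMpos : 0 < M := by positivity
  refine ⟨8 * M * (1 + 2 * LOD.betaTilde Ω A) * C, by positivity, ?_⟩
  intro Cres hres κ hκ T hσ hq hh β hβ
  have hco := hres.2 κ hκ T hσ hq hh β hβ
  have hco' : ∀ w ∈ T.W, 1 / 4 * LOD.normκ κ w ^ 2 ≤ LOD.aForm A κ β w w := fun w hw =>
    le_trans (le_add_of_nonneg_right (by positivity)) (hco w hw)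
  have hsz := T.size_pos hd0 hne
  refine ⟨T.existsUnique_isL2Proj ho, fun v _ K _ => T.existsUnique_isElementCorrector hAm hκ hco' v K,
    T.existsUnique_isRitzProj hAm hκ hco' ho, ?_⟩
  intro z f hz r p hr hp
  simp only [LOD.l2Inner_coe] at hz
  constructor
  · refine (LOD.normκ_sub_ritz_le_of_solution hC T ho hAm hκ hβ hsz hco hz hr hp).trans ?_
    have h0 : 0 ≤ M * LOD.betaTilde Ω A * C * (T.size * κ * ‖f - LOD.toL2 p‖) := by positivity
    rw [← hM]
    linarith
  · refine (LOD.norm_sub_ritz_le hC T ho hAm hκ hβ hsz hco hr).trans ?_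
    have := LOD.normκ_nonneg κ (z - r)
    have h0 : 0 ≤ M * (1 + 2 * LOD.betaTilde Ω A) * C *
        (T.size * κ * Real.sqrt (1 + β) * LOD.normκ κ (z - r)) := by positivity
    rw [← hM]
    linarith
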